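/- All graphs are finite. By a triangulation we mean a connected graph embedded in the sphere, with at least three vertices, without loops but possibly with parallel edges, in which every face (including the outer one) is bounded by three edges. A maximal planar graph is a simple planar graph to which no edge can be added without violating planarity. A $k$-wheel in a triangulation ($k=2,3,4,5$) consists of a vertex $v$ of degree $k$ (the center) with $k$ distinct neighbours $v_1,\dots,v_k$ in cyclic order, and the cycle $C=v_1v_2\cdots v_kv_1$ formed by the edges opposite to $v$ in the $k$ faces at $v$ (for $k=2$, $C$ consists of two distinct parallel edges). The contracting operations are: - 2-wheel: delete $v$ with its two edges and replace the two parallel edges of $C$ by one edge; - 3-wheel: delete $v$ with its three edges, so that $C$ bounds a face; - 4-wheel (applied only if the minimum degree is at least $4$): delete $v$ with its four edges, identify two nonadjacent opposite neighbours $v_1,v_3$ inside the resulting quadrilateral, and merge the edge $v_1v_2$ of $C$ with $v_3v_2$ and the edge $v_1v_4$ of $C$ with $v_3v_4$; - 5-wheel (applied only if the minimum degree is at least $4$): delete $v$ with its five edges, identify two nonadjacent neighbours $v_2,v_5$ inside the resulting pentagon, and merge the edges $v_1v_2$ and $v_1v_5$ of $C$, so that the edges $v_2v_3,v_3v_4,v_4v_5$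 of $C$ bound a triangular face. The extending operations are the inverses of these deletions and identifications (without the restriction on the minimum degree): they act on an edge, on a triangular face, on a path of length $2$, and on a funnel (a triangular face with an edge from one of its vertices to a further vertex), respectively. All intermediate graphs are required to be triangulations. Theorem. (1) Every triangulation can be reduced to $K_3$ by a finite sequence of contracting 2-, 3-, 4- and 5-wheel operations. In particular, every planar embedding of a maximal planar graph with at least three vertices is a triangulation, and it can be reduced to $K_3$ in this way. (2) Any two triangulations, in particular any two embedded maximal planar graphs with at least three vertices, can be turned into each other, up to isomorphism, by a finite sequence of these four pairs of contracting and extending operations. -/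

import Mathlib

open Relation

/-- A finite multigraph (parallel edges and loops allowed) together with a cyclic order of the edge
ends around every vertex, i.e. a graph cellularly embedded (component by component) in an oriented
surface. Every edge consists of two opposite darts, exchanged by `rev`; the dart `d` leaves the
vertex `src d`, and `rot d` is the counterclockwise next dart around that vertex. A vertex without
darts is isolated. -/
structure RotationSystem where
  Vert : Type
  Dart : Type
  [finVert : Finite Vert]
  [finDart : Finite Dart]
  src : Dart → Vert
  rev : Equiv.Perm Dart
  rot : Equiv.Perm Dart
  rev_rev : ∀ d, rev (rev d) = d
  rev_ne : ∀ d, rev d ≠ d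
  rot_orbits : ∀ a b, src a = src b ↔ rot.SameCycle a b

namespace RotationSystem

attribute [instance] finVert finDart

/-- The end of a dart. -/
def tgt (M : RotationSystem) (d : M.Dart) : M.Vert := M.src (M.rev d)

/-- The next dart along the boundary of the face on the left of a dart. -/
def face (M : RotationSystem) : Equiv.Perm M.Dart := M.rot⁻¹ * M.rev

/-- Two vertices are adjacent if some edge joins them. -/
def Adjacent (M : RotationSystem) (u v : M.Vert) : Prop := ∃ d, M.src d = u ∧ M.tgt d = v

/-- The number of orbits of a permutation. -/
noncomputable def numOrbits {α : Type} (p : Equiv.Perm α) : ℕ :=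
  Nat.card (Quotient (Equiv.Perm.SameCycle.setoid p))

/-- The number of connected components that contain an edge. -/
noncomputable def numComponents (M : RotationSystem) : ℕ :=
  Nat.card (MulAction.orbitRel.Quotient (Subgroup.closure {M.rot, M.rev}) M.Dart)

/-- The surface is a sphere for every component: Euler's formula `v - e + f = 2 c`, where isolated
vertices are left out, `v`, `e`, `f` are the numbers of orbits of `rot`, `rev`, `face` and `c` is
the number of components. (In general `v - e + f = 2 c - 2 g` with `g` the sum of the genera.) -/
def Planar (M : RotationSystem) : Prop :=
  numOrbits M.rot + numOrbits M.face = numOrbits M.rev + 2 * M.numComponents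

/-- `M` is a drawing of the simple graph `G` (up to naming the vertices): exactly one edge joins two
adjacent vertices of `G`, no edge joins two vertices that are equal or not adjacent. -/
def IsDrawingOf {V : Type*} (M : RotationSystem) (G : SimpleGraph V) : Prop :=
  ∃ e : V ≃ M.Vert, ∀ u v,
    (G.Adj u v → ∃! d, M.src d = e u ∧ M.tgt d = e v) ∧ (M.Adjacent (e u) (e v) → G.Adj u v)

/-- Isomorphism of embedded graphs, preserving the orientation. -/
structure Iso (M N : RotationSystem) where
  vert : M.Vert ≃ N.Vert
  dart : M.Dart ≃ N.Dart
  src_dart : ∀ d, N.src (dart d) = vert (M.src d)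
  rev_dart : ∀ d, N.rev (dart d) = dart (M.rev d)
  rot_dart : ∀ d, N.rot (dart d) = dart (M.rot d)

/-- A triangulation of the sphere: a connected plane graph on at least three vertices, without loops
but possibly with parallel edges, in which every face is bounded by three edges. (A face of length
one would be bounded by a loop, so `face ^ 3 = 1` says that all faces have length three.) -/
structure IsTriangulation (M : RotationSystem) : Prop where
  planar : M.Planar
  three_le : 3 ≤ Nat.card M.Vert
  connected : ∀ u v, ReflTransGen M.Adjacent u v
  loopless : ∀ d, M.src d ≠ M.tgt d
  triangular : ∀ d, M.face (M.face (M.face d)) = d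

/-- Every vertex has degree at least `k` (the degree counts edges). -/
def MinDegreeGE (M : RotationSystem) (k : ℕ) : Prop :=
  ∀ v : M.Vert, k ≤ Nat.card {d : M.Dart // M.src d = v}

/-- `s 0, …, s (k-1)` are, in cyclic order, all the darts leaving a vertex of degree `k` (the center),
they end in `k` different vertices, and the `k` faces at the center are triangles. So the center and
its neighbours span a wheel with `k` spokes. -/
structure IsWheel (M : RotationSystem) {k : ℕ} [NeZero k] (s : Fin k → M.Dart) : Prop where
  rot_spoke : ∀ i, M.rot (s i) = s (i + 1)
  tgt_injective : Function.Injective fun i => M.tgt (s i)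
  triangle : ∀ i, M.face (M.face (M.face (s i))) = s i

/-- The edge of the cycle of a wheel that follows the spoke `s i` in its face; it leads from the
`i`-th to the `(i+1)`-st neighbour of the center. -/
def rim (M : RotationSystem) {k : ℕ} (s : Fin k → M.Dart) (i : Fin k) : M.Dart := M.face (s i)

/-- The edge of `d` is not incident with the vertex `c`. -/
def Avoids (M : RotationSystem) (c : M.Vert) (d : M.Dart) : Prop := M.src d ≠ c ∧ M.tgt d ≠ c

/-- The pairs of darts that are identified when the edges of the darts `a` and `b` are merged so that
the start of `a` becomes the end of `b` and the end of `a` the start of `b`. -/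
def Merged (M : RotationSystem) (a b : M.Dart) (d e : M.Dart) : Prop :=
  (d = a ∧ e = M.rev b) ∨ (d = M.rev a ∧ e = b)

/-- As a multigraph (regardless of the embedding), `N` arises from `M` by deleting the vertex `c` and
the edges incident with it, identifying vertices related by `idV`, and merging the edges whose darts
are related by `idE`. The maps `f` and `q` send the vertices and darts that are not deleted to those
of `N`; their values on deleted ones are irrelevant. -/
structure IsDeletionQuotient (M N : RotationSystem) (c : M.Vert) (idV : M.Vert → M.Vert → Prop)
    (idE : M.Dart → M.Dart → Prop) (f : M.Vert → N.Vert) (q : M.Dart → N.Dart) : Prop where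
  vert_surj : ∀ w, ∃ u, u ≠ c ∧ f u = w
  vert_eq : ∀ u v, u ≠ c → v ≠ c → (f u = f v ↔ u = v ∨ idV u v ∨ idV v u)
  dart_surj : ∀ e, ∃ d, M.Avoids c d ∧ q d = e
  dart_eq : ∀ d e, M.Avoids c d → M.Avoids c e → (q d = q e ↔ d = e ∨ idE d e ∨ idE e d)
  src_map : ∀ d, M.Avoids c d → N.src (q d) = f (M.src d)
  rev_map : ∀ d, M.Avoids c d → N.rev (q d) = q (M.rev d)

/-- The faces of `M` that do not contain the center of the wheel `s` are kept. -/
def KeepsFaces (M N : RotationSystem) {k : ℕ} [NeZero k] (s : Fin k → M.Dart)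
    (q : M.Dart → N.Dart) : Prop :=
  ∀ d, M.Avoids (M.src (s 0)) d → (∀ i, d ≠ M.rim s i) → N.face (q d) = q (M.face d)

/-- Contracting 2-wheel operation: delete the center of a 2-wheel and its two edges, then replace the
two parallel edges that formed the cycle of the wheel by one edge. -/
def Contract2 (M N : RotationSystem) : Prop :=
  ∃ s : Fin 2 → M.Dart, M.IsWheel s ∧ M.rim s 1 ≠ M.rev (M.rim s 0) ∧ ∃ f q,
    IsDeletionQuotient M N (M.src (s 0)) (fun _ _ => False)
      (M.Merged (M.rim s 0) (M.rim s 1)) f q ∧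
    KeepsFaces M N s q

/-- Contracting 3-wheel operation: delete a vertex of degree 3 and its three edges; the triangle on
its neighbours becomes a face. -/
def Contract3 (M N : RotationSystem) : Prop :=
  ∃ s : Fin 3 → M.Dart, M.IsWheel s ∧ ∃ f q,
    IsDeletionQuotient M N (M.src (s 0)) (fun _ _ => False) (fun _ _ => False) f q ∧
    KeepsFaces M N s q ∧ ∀ i, N.face (q (M.rim s i)) = q (M.rim s (i + 1))

/-- Contracting 4-wheel operation: delete a vertex of degree 4 and its four edges, then identify two
nonadjacent opposite neighbours (numbers 0 and 2) across the resulting quadrilateral; this merges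
its sides `01` and `12`, and its sides `23` and `30`. The inverse splits the path `1 - 02 - 3`. -/
def Contract4 (M N : RotationSystem) : Prop :=
  ∃ s : Fin 4 → M.Dart, M.IsWheel s ∧ ¬ M.Adjacent (M.tgt (s 0)) (M.tgt (s 2)) ∧ ∃ f q,
    IsDeletionQuotient M N (M.src (s 0))
      (fun u v => u = M.tgt (s 0) ∧ v = M.tgt (s 2))
      (fun d e => M.Merged (M.rim s 0) (M.rim s 1) d e ∨ M.Merged (M.rim s 2) (M.rim s 3) d e)
      f q ∧
    KeepsFaces M N s q

/-- Contracting 5-wheel operation: delete a vertex of degree 5 and its five edges, then identify two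
nonadjacent neighbours (numbers 1 and 4) that are both consecutive to a third one (number 0) across
the resulting pentagon; this merges the sides `01` and `40`, and the remaining sides `12`, `23`, `34`
bound a new triangular face. The inverse acts on the funnel with top 0, middle 14, bottoms 2 and
3. -/
def Contract5 (M N : RotationSystem) : Prop :=
  ∃ s : Fin 5 → M.Dart, M.IsWheel s ∧ ¬ M.Adjacent (M.tgt (s 1)) (M.tgt (s 4)) ∧ ∃ f q,
    IsDeletionQuotient M N (M.src (s 0))
      (fun u v => u = M.tgt (s 1) ∧ v = M.tgt (s 4))
      (M.Merged (M.rim s 4) (M.rim s 0)) f q ∧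
    KeepsFaces M N s q ∧
    N.face (q (M.rim s 1)) = q (M.rim s 2) ∧ N.face (q (M.rim s 2)) = q (M.rim s 3) ∧
    N.face (q (M.rim s 3)) = q (M.rim s 1)

/-- One contracting 2-, 3-, 4- or 5-wheel operation on triangulations; the contracting 4- and 5-wheel
operations are applied only to triangulations of minimum degree at least four. -/
def ContractingStep (M N : RotationSystem) : Prop :=
  M.IsTriangulation ∧ N.IsTriangulation ∧
    (Contract2 M N ∨ Contract3 M N ∨ (M.MinDegreeGE 4 ∧ (Contract4 M N ∨ Contract5 M N)))

/-- One extending 2-, 3-, 4- or 5-wheel operation on triangulations: the inverse of the deletion and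
identification in the corresponding contracting operation. -/
def ExtendingStep (M N : RotationSystem) : Prop :=
  M.IsTriangulation ∧ N.IsTriangulation ∧
    (Contract2 N M ∨ Contract3 N M ∨ Contract4 N M ∨ Contract5 N M)

/-- One of the eight basic operations. -/
def OperationStep (M N : RotationSystem) : Prop := ContractingStep M N ∨ ExtendingStep M N

/-- `M` can be turned into (a copy of) `K₃` by a finite sequence of contracting operations. -/
def ReducesToK3 (M : RotationSystem) : Prop :=
  ∃ T : RotationSystem, ReflTransGen ContractingStep M T ∧
    T.IsDrawingOf (⊤ : SimpleGraph (Fin 3))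

/-- `M` can be turned into (a copy of) `N` by a finite sequence of the eight operations. -/
def TransformsInto (M N : RotationSystem) : Prop :=
  ∃ N' : RotationSystem, ReflTransGen OperationStep M N' ∧ Nonempty (Iso N' N)

end RotationSystem

/-- A finite simple graph is planar if it has a drawing in the plane, or equivalently the sphere. -/
def IsPlanarGraph {V : Type*} (G : SimpleGraph V) : Prop :=
  ∃ M : RotationSystem, M.Planar ∧ M.IsDrawingOf G

/-- A planar graph to which no edge can be added without violating planarity. -/
def IsMaximalPlanarGraph {V : Type*} (G : SimpleGraph V) : Prop :=
  IsPlanarGraph G ∧ ∀ H : SimpleGraph V, G < H → ¬ IsPlanarGraph H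

/-!
Every triangulation with more than three vertices admits a contracting operation that leaves fewer
vertices, so it reduces to a triangulation with three vertices, which must be `K₃`. Since any two copies
of `K₃` are isomorphic, reversing one of two reductions transforms any triangulation into any other.

The topology of the sphere enters through linear algebra over `ℚ`. Functions on the darts that are
invariant under the rotation, or under the face permutation, span a space of dimension
`v + f - c`, inside the space `jumpAntisymmetric` of dimension `e + c`. This gives Euler's inequality
for every rotation system (`euler_inequality`) and shows that planarity is equivalent to equality of the
two spaces (`euler_equality_iff`). That equality is a Jordan curve theorem (`Planar.jordan`): a closed
walk is the boundary of a function of the faces. It is also a criterion for planarity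
(`planar_of_potential`).

Because of the case of equality in Euler's inequality, a connected surface glued from triangles is a
triangulation of the sphere as soon as the numbers of darts and vertices fit
(`exists_triangulation`). So the results of the four contracting operations, which are all obtained by
the surgery `IsWheel.exists_surgery`, are triangulations by counting, without tracing any rotation.

It remains to find a wheel. A vertex of degree two or three gives one. If all degrees are at least
four, a vertex of degree four or five is needed without parallel edges; it exists in the whole graph or,
if there are parallel edges, inside a minimal digon (`exists_low_degree`). Two nonadjacent neighbours
with the required position exist as two crossing chords would contradict the Jordan curve theorem
(`IsWheel.exists_potential_of_adjacent`).

Finally, a plane drawing of a maximal planar graph is a triangulation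
(`isTriangulation_of_isMaximalPlanarGraph`), because otherwise an edge can be added: planarity of the
larger drawing follows from the criterion, and the nonadjacency of suitable vertices on a face from the
Jordan curve theorem.
-/

namespace RotationSystem

/-! ### Euler's formula by linear algebra -/

section LinearAlgebra
variable {D : Type}

/-- The rational functions invariant under a permutation. -/
def invariants (σ : Equiv.Perm D) : Submodule ℚ (D → ℚ) where
  carrier := {g | ∀ d, g (σ d) = g d}
  add_mem' := by intro a b ha hb d; simp [ha d, hb d]
  zero_mem' := by intro d; rfl
  smul_mem' := by intro c a ha d; simp [ha d]

lemma mem_invariants {σ : Equiv.Perm D} {g : D → ℚ} :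
    g ∈ invariants σ ↔ ∀ d, g (σ d) = g d := Iff.rfl

/-- The functions that are constant on the classes of an equivalence relation form a space whose
dimension is the number of classes. -/
lemma finrank_of_const [Finite D] (r : Setoid D) (S : Submodule ℚ (D → ℚ))
    (hS : ∀ g, g ∈ S ↔ ∀ a b, r a b → g a = g b) :
    Module.finrank ℚ S = Nat.card (Quotient r) := by
  classical
  cases nonempty_fintype D
  have : Fintype (Quotient r) := Fintype.ofFinite _
  have hinj : Function.Injective (LinearMap.funLeft ℚ ℚ (Quotient.mk r)) :=
    LinearMap.funLeft_injective_of_surjective _ _ _ Quotient.mk_surjective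
  have hr : LinearMap.range (LinearMap.funLeft ℚ ℚ (Quotient.mk r)) = S := by
    ext g
    rw [hS]
    constructor
    · rintro ⟨h, rfl⟩ a b hab
      simp only [LinearMap.funLeft_apply]
      rw [Quotient.sound hab]
    · intro h
      exact ⟨fun x => Quotient.lift g h x, by ext d; rfl⟩
  rw [← hr, LinearMap.finrank_range_of_inj hinj, Module.finrank_pi, Nat.card_eq_fintype_card]

lemma invariant_of_sameCycle {β : Type*} {σ : Equiv.Perm D} {g : D → β} (hg : ∀ d, g (σ d) = g d)
    {a b : D} (h : σ.SameCycle a b) : g a = g b := by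
  obtain ⟨n, rfl⟩ := h
  have hinv : ∀ d, g (σ⁻¹ d) = g d := fun d => by
    have := hg (σ⁻¹ d); simpa using this.symm
  induction n with
  | zero => simp
  | succ i ih => rw [add_comm, zpow_add, Equiv.Perm.mul_apply, zpow_one, hg]; exact ih
  | pred i ih =>
    rw [sub_eq_neg_add, zpow_add, Equiv.Perm.mul_apply, zpow_neg_one, hinv]; exact ih

lemma finrank_invariants [Finite D] (σ : Equiv.Perm D) :
    Module.finrank ℚ (invariants σ) = numOrbits σ := by
  refine finrank_of_const (Equiv.Perm.SameCycle.setoid σ) _ fun g => ?_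
  constructor
  · intro h a b hab
    exact invariant_of_sameCycle h hab
  · intro h d
    exact h _ _ ((Equiv.Perm.sameCycle_apply_left).2 (Equiv.Perm.SameCycle.refl _ _))

/-- The number of orbits of the group generated by two permutations. For the rotation and the reversal
of a `RotationSystem` this is definitionally `numComponents`. -/
noncomputable def numComp (σ α : Equiv.Perm D) : ℕ :=
  Nat.card (MulAction.orbitRel.Quotient (Subgroup.closure {σ, α}) D)

lemma finrank_invariants_inf [Finite D] (σ α : Equiv.Perm D) :
    Module.finrank ℚ ↥(invariants σ ⊓ invariants α) = numComp σ α := by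
  refine finrank_of_const (MulAction.orbitRel (Subgroup.closure {σ, α}) D) _ fun g => ?_
  constructor
  · rintro ⟨h1, h2⟩ a b hab
    obtain ⟨⟨τ, hτ⟩, rfl⟩ := hab
    change g (τ b) = g b
    induction hτ using Subgroup.closure_induction generalizing b with
    | mem x hx =>
      rcases hx with rfl | rfl
      · exact h1 b
      · exact h2 b
    | one => rfl
    | mul x y _ _ hx hy => rw [Equiv.Perm.mul_apply, hx, hy]
    | inv x _ hx => have := hx (x⁻¹ b); simpa using this.symm
  · intro h
    exact ⟨fun d => h _ _ ⟨⟨σ, Subgroup.subset_closure (by simp)⟩, rfl⟩,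
      fun d => h _ _ ⟨⟨α, Subgroup.subset_closure (by simp)⟩, rfl⟩⟩

/-- The functions `g` on the darts whose jumps `g d - g (σ⁻¹ d)` around the vertices are antisymmetric
under the reversal `α`. Such a jump is a circulation: its values at each vertex add up to zero. -/
def jumpAntisymmetric (σ α : Equiv.Perm D) : Submodule ℚ (D → ℚ) where
  carrier := {g | ∀ d, g d - g (σ⁻¹ d) + (g (α d) - g (σ⁻¹ (α d))) = 0}
  add_mem' := by
    intro a b ha hb d
    have := ha d; have := hb d
    simp only [Pi.add_apply]; linarith
  zero_mem' := by intro d; simp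
  smul_mem' := by
    intro c a ha d
    have := ha d
    simp only [Pi.smul_apply, smul_eq_mul]
    linear_combination c * this

lemma finrank_ker_eq_of_adjoint [Fintype D] (L L' : (D → ℚ) →ₗ[ℚ] (D → ℚ))
    (h : ∀ g w : D → ℚ, L g ⬝ᵥ w = g ⬝ᵥ L' w) :
    Module.finrank ℚ (LinearMap.ker L) = Module.finrank ℚ (LinearMap.ker L') := by
  classical
  have hm : LinearMap.toMatrix' L' = (LinearMap.toMatrix' L).transpose := by
    ext i j
    have := h (Pi.single i 1) (Pi.single j 1)
    simp only [dotProduct_single, single_dotProduct, mul_one, one_mul] at this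
    simp [LinearMap.toMatrix'_apply, this]
  have hr : Module.finrank ℚ (LinearMap.range L) = Module.finrank ℚ (LinearMap.range L') := by
    have h1 : (LinearMap.toMatrix' L').rank = (LinearMap.toMatrix' L).rank := by
      rw [hm, Matrix.rank_transpose]
    have h2 : ∀ T : (D → ℚ) →ₗ[ℚ] (D → ℚ),
        (LinearMap.toMatrix' T).rank = Module.finrank ℚ (LinearMap.range T) := fun T => by
      rw [Matrix.rank, ← Matrix.toLin'_apply', Matrix.toLin'_toMatrix']
    rw [← h2, ← h2, h1]
  have a1 := LinearMap.finrank_range_add_finrank_ker L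
  have a2 := LinearMap.finrank_range_add_finrank_ker L'
  omega

lemma finrank_comap {V W : Type*} [AddCommGroup V] [Module ℚ V] [FiniteDimensional ℚ V]
    [AddCommGroup W] [Module ℚ W] (T : V →ₗ[ℚ] W) (S : Submodule ℚ W)
    (hS : S ≤ LinearMap.range T) :
    Module.finrank ℚ (S.comap T) = Module.finrank ℚ (LinearMap.ker T) + Module.finrank ℚ S := by
  have h := LinearMap.finrank_range_add_finrank_ker (T.domRestrict (S.comap T))
  have h1 : LinearMap.range (T.domRestrict (S.comap T)) = S := by
    rw [LinearMap.range_domRestrict, Submodule.map_comap_eq, inf_eq_right.2 hS]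
  have h2 : Module.finrank ℚ (LinearMap.ker (T.domRestrict (S.comap T))) =
      Module.finrank ℚ (LinearMap.ker T) := by
    rw [LinearMap.ker_domRestrict]
    have hle : LinearMap.ker T ≤ S.comap T := fun x hx => by
      simp [LinearMap.mem_ker.1 hx]
    exact (Submodule.comapSubtypeEquivOfLe hle).finrank_eq
  rw [h1, h2] at h
  omega

/-- The dimension of `jumpAntisymmetric σ α` is the number of edges plus the number of components. It
is the kernel of `(1 + α*) (1 - σ⁻¹*)`, which has the same rank as its transpose
`(1 - σ*) (1 + α*)`, whose kernel is the preimage under `1 + α*` of the functions invariant under both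
permutations. -/
lemma finrank_jumpAntisymmetric [Finite D] (σ α : Equiv.Perm D) (hα : ∀ d, α (α d) = d) :
    Module.finrank ℚ (jumpAntisymmetric σ α) + numOrbits α = Nat.card D + numComp σ α := by
  classical
  cases nonempty_fintype D
  let P : Equiv.Perm D → ((D → ℚ) →ₗ[ℚ] (D → ℚ)) := fun τ => LinearMap.funLeft ℚ ℚ τ
  let A := LinearMap.id + P α
  let B := LinearMap.id - P σ⁻¹
  let B' := LinearMap.id - P σ
  have hadj : ∀ (τ : Equiv.Perm D) (g w : D → ℚ), (g ∘ τ) ⬝ᵥ w = g ⬝ᵥ (w ∘ (τ⁻¹ : Equiv.Perm D)) := by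
    intro τ g w
    simp only [dotProduct]
    exact Fintype.sum_equiv τ _ _ (fun d => by simp)
  have hα' : α⁻¹ = α := by ext d; rw [Equiv.Perm.inv_eq_iff_eq]; exact (hα d).symm
  have h1 : jumpAntisymmetric σ α = LinearMap.ker (A ∘ₗ B) := by
    ext g
    rw [LinearMap.mem_ker, funext_iff]
    rfl
  have h2 : Module.finrank ℚ (LinearMap.ker (A ∘ₗ B)) = Module.finrank ℚ (LinearMap.ker (B' ∘ₗ A)) := by
    refine finrank_ker_eq_of_adjoint _ _ fun g w => ?_
    have e1 : ∀ u v : D → ℚ, A u ⬝ᵥ v = u ⬝ᵥ A v := fun u v => by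
      change (u + u ∘ α) ⬝ᵥ v = u ⬝ᵥ (v + v ∘ α)
      rw [add_dotProduct, dotProduct_add, hadj, hα']
    have e2 : ∀ u v : D → ℚ, B u ⬝ᵥ v = u ⬝ᵥ B' v := fun u v => by
      change (u - u ∘ (σ⁻¹ : Equiv.Perm D)) ⬝ᵥ v = u ⬝ᵥ (v - v ∘ σ)
      rw [sub_dotProduct, dotProduct_sub, hadj, inv_inv]
    simp only [LinearMap.comp_apply]
    rw [e1, e2]
  have hrange : LinearMap.range A = invariants α := by
    ext g
    constructor
    · rintro ⟨u, rfl⟩ d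
      change u (α d) + u (α (α d)) = u d + u (α d)
      rw [hα, add_comm]
    · intro hg
      refine ⟨(1 / 2 : ℚ) • g, ?_⟩
      ext d
      change (1 / 2 : ℚ) * g d + (1 / 2 : ℚ) * g (α d) = g d
      rw [hg d]; ring
  have h3 : LinearMap.ker (B' ∘ₗ A) = (invariants σ ⊓ invariants α).comap A := by
    ext g
    rw [Submodule.mem_comap, Submodule.mem_inf, LinearMap.mem_ker]
    constructor
    · intro h
      refine ⟨fun d => ?_, hrange ▸ LinearMap.mem_range_self A g⟩
      have := congrFun h d
      change A g d - A g (σ d) = 0 at this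
      linarith
    · rintro ⟨h, -⟩
      ext d
      change A g d - A g (σ d) = 0
      rw [h d, sub_self]
  have h4 := finrank_comap A (invariants σ ⊓ invariants α) (hrange ▸ inf_le_right)
  have h5 := LinearMap.finrank_range_add_finrank_ker A
  rw [hrange, finrank_invariants, Module.finrank_pi, ← Nat.card_eq_fintype_card] at h5
  rw [finrank_invariants_inf] at h4
  rw [h1, h2, h3]
  omega

lemma invariants_inf_face (σ α : Equiv.Perm D) :
    invariants σ ⊓ invariants (σ⁻¹ * α) = invariants σ ⊓ invariants α := by
  ext g
  simp only [Submodule.mem_inf, mem_invariants, Equiv.Perm.mul_apply]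
  refine and_congr_right fun h => forall_congr' fun d => ?_
  have e : σ (σ⁻¹ (α d)) = α d := by simp
  rw [← h (σ⁻¹ (α d)), e]

lemma invariants_sup_le (σ α : Equiv.Perm D) (hα : ∀ d, α (α d) = d) :
    invariants σ ⊔ invariants (σ⁻¹ * α) ≤ jumpAntisymmetric σ α := by
  refine sup_le (fun g hg d => ?_) (fun g hg d => ?_)
  · have h : ∀ d, g (σ⁻¹ d) = g d := fun d => by simpa using (hg (σ⁻¹ d)).symm
    rw [h, h]; ring
  · have h1 := hg d
    have h2 := hg (α d)
    simp only [Equiv.Perm.mul_apply, hα] at h1 h2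
    rw [h1, h2]; ring

lemma finrank_invariants_sup [Finite D] (σ α : Equiv.Perm D) :
    Module.finrank ℚ ↥(invariants σ ⊔ invariants (σ⁻¹ * α)) + numComp σ α =
      numOrbits σ + numOrbits (σ⁻¹ * α) := by
  have := Submodule.finrank_sup_add_finrank_inf_eq (invariants σ) (invariants (σ⁻¹ * α))
  rw [invariants_inf_face, finrank_invariants_inf, finrank_invariants, finrank_invariants] at this
  exact this

/-- If all orbits of `σ` have `n` elements, their number is the cardinality divided by `n`. -/
lemma card_eq_mul_numOrbits [Finite D] (σ : Equiv.Perm D) (n : ℕ) (hn : ∀ d, (σ ^ n) d = d)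
    (hinj : ∀ d, ∀ i < n, ∀ j < n, (σ ^ i) d = (σ ^ j) d → i = j) (hpos : 0 < n) :
    Nat.card D = n * numOrbits σ := by
  classical
  let r := Equiv.Perm.SameCycle.setoid σ
  have key : Function.Bijective (fun x : Fin n × Quotient r => (σ ^ (x.1 : ℕ)) x.2.out) := by
    constructor
    · rintro ⟨i, x⟩ ⟨j, y⟩ h
      simp only at h
      have hxy : x = y := by
        rw [← Quotient.out_eq x, ← Quotient.out_eq y]
        apply Quotient.sound
        have : σ.SameCycle ((σ ^ (i : ℕ)) x.out) ((σ ^ (j : ℕ)) y.out) := by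
          rw [h]
        exact (Equiv.Perm.sameCycle_pow_left.1 (Equiv.Perm.sameCycle_pow_right.1 this))
      subst hxy
      have := hinj _ i i.2 j j.2 h
      simp [Fin.ext_iff, this]
    · intro d
      have h : σ.SameCycle (Quotient.mk r d).out d := Quotient.mk_out (s := r) d
      obtain ⟨m, hm⟩ := h
      have hσn : σ ^ n = 1 := by ext x; simp [hn]
      have hn0 : (n : ℤ) ≠ 0 := by omega
      refine ⟨(⟨(m % n).toNat, ?_⟩, Quotient.mk r d), ?_⟩
      · have := Int.emod_lt_of_pos m (by omega : (0 : ℤ) < n)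
        have := Int.emod_nonneg m hn0
        omega
      · simp only
        rw [← zpow_natCast, Int.toNat_of_nonneg (Int.emod_nonneg m hn0)]
        conv_rhs => rw [← hm, ← Int.mul_ediv_add_emod m n, zpow_add, zpow_mul, zpow_natCast, hσn]
        simp
  rw [← Nat.card_eq_of_bijective _ key, Nat.card_prod, Nat.card_eq_fintype_card, Fintype.card_fin]
  rfl

lemma card_eq_two_mul [Finite D] (α : Equiv.Perm D) (hα : ∀ d, α (α d) = d) (hne : ∀ d, α d ≠ d) :
    Nat.card D = 2 * numOrbits α := by
  refine card_eq_mul_numOrbits α 2 (fun d => by simp [pow_two, hα]) ?_ (by norm_num)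
  intro d i hi j hj h
  interval_cases i <;> interval_cases j <;> simp_all
  exact hne d h.symm

lemma card_eq_three_mul [Finite D] (φ : Equiv.Perm D) (h3 : ∀ d, φ (φ (φ d)) = d)
    (hne : ∀ d, φ d ≠ d) : Nat.card D = 3 * numOrbits φ := by
  have hne2 : ∀ d, φ (φ d) ≠ d := fun d h => hne d (by
    have := h3 d; rw [h] at this; exact this)
  refine card_eq_mul_numOrbits φ 3 (fun d => by simp [pow_succ, h3]) ?_ (by norm_num)
  intro d i hi j hj h
  interval_cases i <;> interval_cases j <;> simp_all [pow_succ]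
  all_goals first | exact hne _ h.symm | exact hne2 _ h.symm

/-- Euler's inequality: the genus of an oriented surface is not negative. -/
lemma euler_inequality [Finite D] (σ α : Equiv.Perm D) (hα : ∀ d, α (α d) = d)
    (hne : ∀ d, α d ≠ d) :
    numOrbits σ + numOrbits (σ⁻¹ * α) ≤ numOrbits α + 2 * numComp σ α := by
  have h1 := Submodule.finrank_mono (invariants_sup_le σ α hα)
  have h2 := finrank_invariants_sup σ α
  have h3 := finrank_jumpAntisymmetric σ α hα
  have h4 := card_eq_two_mul α hα hne
  omega

/-- Equality in Euler's formula means that every circulation comes from a function of the faces. -/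
lemma euler_equality_iff [Finite D] (σ α : Equiv.Perm D) (hα : ∀ d, α (α d) = d)
    (hne : ∀ d, α d ≠ d) :
    numOrbits σ + numOrbits (σ⁻¹ * α) = numOrbits α + 2 * numComp σ α ↔
      jumpAntisymmetric σ α ≤ invariants σ ⊔ invariants (σ⁻¹ * α) := by
  have h1 := invariants_sup_le σ α hα
  have h2 := finrank_invariants_sup σ α
  have h3 := finrank_jumpAntisymmetric σ α hα
  have h4 := card_eq_two_mul α hα hne
  constructor
  · intro h
    refine (Submodule.eq_of_le_of_finrank_eq h1 ?_).ge
    omega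
  · intro h
    rw [le_antisymm h1 h] at h2
    omega

end LinearAlgebra

/-! ### The Jordan curve theorem, and triangulations recognized by counting -/

section Basic
variable (M : RotationSystem)

lemma rot_face (d : M.Dart) : M.rot (M.face d) = M.rev d := by simp [face]

lemma face_rev (d : M.Dart) : M.face (M.rev d) = M.rot⁻¹ d := by simp [face, M.rev_rev]

lemma face_rev_rot (d : M.Dart) : M.face (M.rev (M.rot d)) = d := by simp [face_rev]

lemma src_rot (d : M.Dart) : M.src (M.rot d) = M.src d :=
  (M.rot_orbits _ _).2 (Equiv.Perm.sameCycle_apply_left.2 (Equiv.Perm.SameCycle.refl _ _))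

lemma src_face (d : M.Dart) : M.src (M.face d) = M.tgt d := by
  rw [← M.src_rot, M.rot_face]; rfl

lemma src_rev (d : M.Dart) : M.src (M.rev d) = M.tgt d := rfl

lemma tgt_rev (d : M.Dart) : M.tgt (M.rev d) = M.src d := by simp [tgt, M.rev_rev]

lemma rev_inj {d e : M.Dart} (h : M.rev d = e) : d = M.rev e := by rw [← h, M.rev_rev]

lemma Adjacent.symm {M : RotationSystem} {u v : M.Vert} (h : M.Adjacent u v) : M.Adjacent v u := by
  obtain ⟨d, rfl, rfl⟩ := h
  exact ⟨M.rev d, rfl, M.tgt_rev d⟩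

/-- A function that does not change under the rotation at `v` is constant on the darts leaving `v`. -/
lemma eq_of_src_eq {β : Type*} {g : M.Dart → β} {v : M.Vert}
    (hg : ∀ d, M.src d = v → g (M.rot d) = g d) {a b : M.Dart} (ha : M.src a = v)
    (hb : M.src b = v) : g a = g b := by
  classical
  let g' : M.Dart → Option β := fun d => if M.src d = v then some (g d) else none
  have h : g' a = g' b := by
    refine invariant_of_sameCycle (σ := M.rot) (fun d => ?_) ((M.rot_orbits a b).1 (ha.trans hb.symm))
    by_cases hd : M.src d = v
    · simp [g', M.src_rot, hd, hg d hd]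
    · simp [g', M.src_rot, hd]
  simpa [g', ha, hb] using h

open Classical in
lemma vertex_sum_rot [Fintype M.Dart] (z : M.Dart → ℚ) (v : M.Vert) :
    ∑ d with M.src d = v, z (M.rot d) = ∑ d with M.src d = v, z d :=
  Finset.sum_equiv M.rot (fun d => by simp [M.src_rot]) (fun d _ => rfl)

open Classical in
/-- Around every vertex, the jumps of a function of the faces add up to zero. -/
lemma vertex_sum_jump [Fintype M.Dart] (φ : M.Dart → ℚ) (hφ : ∀ d, φ (M.face d) = φ d)
    (v : M.Vert) : ∑ d with M.src d = v, (φ d - φ (M.rev d)) = 0 := by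
  rw [Finset.sum_sub_distrib, sub_eq_zero, ← M.vertex_sum_rot (fun d => φ (M.rev d))]
  refine Finset.sum_congr rfl fun d _ => ?_
  rw [← hφ (M.rev (M.rot d)), M.face_rev_rot]

open Classical in
/-- A function whose values at each vertex add up to zero is the increment of some function along the
rotation. -/
lemma exists_rot_coboundary [Fintype M.Dart] (z : M.Dart → ℚ)
    (hz : ∀ v, ∑ d with M.src d = v, z d = 0) :
    ∃ g : M.Dart → ℚ, ∀ d, g (M.rot d) - g d = z d := by
  obtain ⟨n, hn, hpow⟩ : ∃ n, 0 < n ∧ M.rot ^ n = 1 :=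
    ⟨orderOf M.rot, orderOf_pos _, pow_orderOf_eq_one _⟩
  have hn' : (n : ℚ) ≠ 0 := by positivity
  have hshift : ∀ (w : M.Dart → ℚ) (d : M.Dart),
      ∑ j ∈ Finset.range n, w ((M.rot ^ (j + 1)) d) = ∑ j ∈ Finset.range n, w ((M.rot ^ j) d) := by
    intro w d
    have h1 := Finset.sum_range_succ (fun j => w ((M.rot ^ j) d)) n
    have h2 := Finset.sum_range_succ' (fun j => w ((M.rot ^ j) d)) n
    simp only [hpow, pow_zero] at h1 h2
    linarith
  have hN : ∀ d, ∑ j ∈ Finset.range n, z ((M.rot ^ j) d) = 0 := by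
    intro d
    have hconst : ∀ e, M.src e = M.src d →
        ∑ j ∈ Finset.range n, z ((M.rot ^ j) e) = ∑ j ∈ Finset.range n, z ((M.rot ^ j) d) := by
      intro e he
      refine M.eq_of_src_eq (g := fun e => ∑ j ∈ Finset.range n, z ((M.rot ^ j) e))
        (fun x _ => ?_) he rfl
      simp only [← Equiv.Perm.mul_apply, ← pow_succ]
      exact hshift z x
    have h0 : ∀ j, ∑ e with M.src e = M.src d, z ((M.rot ^ j) e) = 0 := by
      intro j
      induction j with
      | zero => simpa using hz _
      | succ j ih =>
        rw [← ih, ← M.vertex_sum_rot (fun e => z ((M.rot ^ j) e))]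
        simp [pow_succ]
    have h1 : ∑ e with M.src e = M.src d, ∑ j ∈ Finset.range n, z ((M.rot ^ j) e) = 0 := by
      rw [Finset.sum_comm]
      exact Finset.sum_eq_zero fun j _ => h0 j
    rw [Finset.sum_congr rfl (fun e he => hconst e (by simpa using he)), Finset.sum_const,
      nsmul_eq_mul] at h1
    refine (mul_eq_zero.1 h1).resolve_left ?_
    exact Nat.cast_ne_zero.2 (Finset.card_ne_zero.2 ⟨d, by simp⟩)
  -- the usual primitive of a norm-zero element for the action of a cyclic group of order `n`
  refine ⟨fun d => (∑ j ∈ Finset.range n, (j : ℚ) * z ((M.rot ^ j) d)) / n, fun d => ?_⟩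
  have h1 := Finset.sum_range_succ' (fun j => (j : ℚ) * z ((M.rot ^ j) d)) n
  rw [Finset.sum_range_succ, hpow] at h1
  have h2 : ∑ j ∈ Finset.range n, ((j + 1 : ℕ) : ℚ) * z ((M.rot ^ (j + 1)) d) =
      ∑ j ∈ Finset.range n, (j : ℚ) * z ((M.rot ^ j) (M.rot d)) +
      ∑ j ∈ Finset.range n, z ((M.rot ^ j) d) := by
    rw [← hshift z d, ← Finset.sum_add_distrib]
    refine Finset.sum_congr rfl fun j _ => ?_
    rw [pow_succ, Equiv.Perm.mul_apply]; push_cast; ring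
  rw [h2, hN] at h1
  simp only [Equiv.Perm.one_apply] at h1
  simp only
  field_simp
  simp at h1
  linarith

lemma planar_iff_jumpAntisymmetric : M.Planar ↔
    jumpAntisymmetric M.rot M.rev ≤ invariants M.rot ⊔ invariants M.face :=
  euler_equality_iff M.rot M.rev M.rev_rev M.rev_ne

open Classical in
/-- In a plane graph, a circulation is the jump of a function of the faces. -/
lemma Planar.exists_face_potential {M : RotationSystem} (hM : M.Planar) [Fintype M.Dart]
    (z : M.Dart → ℚ) (hanti : ∀ d, z (M.rev d) = -z d)
    (hz : ∀ v, ∑ d with M.src d = v, z d = 0) :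
    ∃ φ : M.Dart → ℚ, (∀ d, φ (M.face d) = φ d) ∧ ∀ d, φ d - φ (M.rev d) = z d := by
  obtain ⟨g, hg⟩ := M.exists_rot_coboundary (fun d => z (M.rot d))
    (fun v => by rw [M.vertex_sum_rot, hz])
  have hg' : ∀ d, g d - g (M.rot⁻¹ d) = z d := fun d => by simpa using hg (M.rot⁻¹ d)
  have hmem : g ∈ jumpAntisymmetric M.rot M.rev := fun d => by
    rw [hg', hg', hanti]; ring
  obtain ⟨p, hp, φ, hφ, rfl⟩ := Submodule.mem_sup.1 (M.planar_iff_jumpAntisymmetric.1 hM hmem)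
  refine ⟨φ, hφ, fun d => ?_⟩
  have h1 : p (M.rot⁻¹ d) = p d := by simpa using (hp (M.rot⁻¹ d)).symm
  have h2 := hφ (M.rev d)
  rw [M.face_rev] at h2
  rw [← hg' d, Pi.add_apply, Pi.add_apply, h1, h2]
  ring

open Classical in
/-- A form of the Jordan curve theorem: given the darts `l` of a closed walk in a plane graph, the
faces can be labelled (by a winding number) such that the label changes exactly across the walk. The
hypothesis that starts and ends agree as multisets is all of closedness that matters. -/
lemma Planar.jordan {M : RotationSystem} (hM : M.Planar) (l : List M.Dart)
    (hl : (l.map M.src).Perm (l.map M.tgt)) :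
    ∃ φ : M.Dart → ℚ, (∀ d, φ (M.face d) = φ d) ∧
      ∀ d, φ d - φ (M.rev d) = (l.count d : ℚ) - l.count (M.rev d) := by
  cases nonempty_fintype M.Dart
  refine hM.exists_face_potential _ (fun d => by rw [M.rev_rev]; ring) fun v => ?_
  have h1 : ∀ l : List M.Dart, ∑ d with M.src d = v, (l.count d : ℚ) = (l.map M.src).count v := by
    intro l
    induction l with
    | nil => simp
    | cons a l ih =>
      simp only [List.count_cons, List.map_cons, Nat.cast_add, Finset.sum_add_distrib, ih]
      congr 1
      by_cases h : M.src a = v <;> simp [Finset.sum_ite_eq, h]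
  have h2 : ∀ l : List M.Dart, ∑ d with M.src d = v, (l.count (M.rev d) : ℚ) =
      (l.map M.tgt).count v := by
    intro l
    have h3 : ∀ d, l.count (M.rev d) = (l.map M.rev).count d := fun d => by
      conv_rhs => rw [← M.rev_rev d]
      rw [List.count_map_of_injective _ _ M.rev.injective]
    simp only [h3, h1, List.map_map]
    rfl
  rw [Finset.sum_sub_distrib, h1, h2, hl.count_eq, sub_self]

/-- Converse of `Planar.exists_vertex_potential`: a graph is plane if every antisymmetric function that
adds up to zero along every face (expressed as being an increment along the faces) is the difference
of a function of the vertices. -/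
lemma planar_of_potential (h : ∀ y g : M.Dart → ℚ, (∀ d, y (M.rev d) = -y d) →
    (∀ d, g (M.face d) - g d = y d) →
    ∃ p : M.Vert → ℚ, ∀ d, y d = p (M.tgt d) - p (M.src d)) : M.Planar := by
  refine M.planar_iff_jumpAntisymmetric.2 fun g hg => ?_
  have hanti : ∀ d, g (M.face (M.rev d)) - g (M.rev d) = -(g (M.face d) - g d) := fun d => by
    have := hg d
    have e1 : M.face d = M.rot⁻¹ (M.rev d) := rfl
    rw [M.face_rev, e1]
    linarith
  obtain ⟨p, hp⟩ := h (fun d => g (M.face d) - g d) g hanti (fun d => rfl)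
  refine Submodule.mem_sup.2 ⟨fun d => p (M.src d), fun d => ?_, fun d => g d - p (M.src d),
    fun d => ?_, by ext d; simp⟩
  · simp only [M.src_rot]
  · have := hp d
    simp only [M.src_face] at this ⊢
    linarith

/-- In a plane graph, an antisymmetric function that adds up to zero along every face is the
difference of a function of the vertices. -/
lemma Planar.exists_vertex_potential {M : RotationSystem} (hM : M.Planar) (y g : M.Dart → ℚ)
    (hy : ∀ d, y (M.rev d) = -y d) (hg : ∀ d, g (M.face d) - g d = y d) :
    ∃ p : M.Vert → ℚ, ∀ d, y d = p (M.tgt d) - p (M.src d) := by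
  have hmem : g ∈ jumpAntisymmetric M.rot M.rev := fun d => by
    have h1 := hg d
    have h2 := hg (M.rev d)
    have e1 : M.face d = M.rot⁻¹ (M.rev d) := rfl
    rw [M.face_rev, hy] at h2
    rw [e1] at h1
    linarith
  obtain ⟨p, hp, φ, hφ, rfl⟩ := Submodule.mem_sup.1 (M.planar_iff_jumpAntisymmetric.1 hM hmem)
  classical
  obtain ⟨q, hq⟩ : ∃ q : M.Vert → ℚ, ∀ d, q (M.src d) = p d := by
    refine ⟨fun v => if h : ∃ d, M.src d = v then p h.choose else 0, fun d => ?_⟩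
    have h : ∃ e, M.src e = M.src d := ⟨d, rfl⟩
    exact (dif_pos h).trans (M.eq_of_src_eq (fun e _ => hp e) h.choose_spec rfl)
  refine ⟨q, fun d => ?_⟩
  rw [tgt, hq, hq, ← hg d, Pi.add_apply, Pi.add_apply, hφ d, ← M.rot_face d, hp]
  ring

end Basic

section Euler
variable {D : Type} [Nonempty D]

lemma numComp_eq_one (σ α : Equiv.Perm D)
    (h : ∀ S : Set D, S.Nonempty → (∀ d ∈ S, (σ⁻¹ * α) d ∈ S) → (∀ d ∈ S, α d ∈ S) → S = Set.univ) :
    numComp σ α = 1 := by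
  rw [numComp, Nat.card_eq_one_iff_unique]
  refine ⟨⟨fun x y => ?_⟩, ⟨Quotient.mk _ (Classical.arbitrary D)⟩⟩
  induction x using Quotient.inductionOn with | _ a
  induction y using Quotient.inductionOn with | _ b
  apply Quotient.sound
  have hS := h {x | (MulAction.orbitRel (Subgroup.closure {σ, α}) D) x b} ⟨b, ⟨1, one_smul _ b⟩⟩
    ?_ ?_
  · exact Set.eq_univ_iff_forall.1 hS a
  · rintro d ⟨g, rfl⟩
    exact ⟨⟨σ⁻¹ * α, mul_mem (inv_mem (Subgroup.subset_closure (by simp)))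
      (Subgroup.subset_closure (by simp))⟩ * g, mul_smul _ _ _⟩
  · rintro d ⟨g, rfl⟩
    exact ⟨⟨α, Subgroup.subset_closure (by simp)⟩ * g, mul_smul _ _ _⟩

/-- Euler's inequality for a connected surface glued from triangles along `α`. The labels `src` need
only be constant on the vertices, so that `V` may be smaller than the set of vertices; in the case of
equality the labels do separate the vertices. -/
lemma six_mul_card_le [Finite D] {V : Type*} [Finite V] (φ α : Equiv.Perm D) (src : D → V)
    (hα : ∀ d, α (α d) = d) (hne : ∀ d, α d ≠ d) (h3 : ∀ d, φ (φ (φ d)) = d)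
    (hφ : ∀ d, φ d ≠ d) (hsrc : ∀ d, src (α d) = src (φ d)) (hsurj : Function.Surjective src)
    (htrans : ∀ S : Set D, S.Nonempty → (∀ d ∈ S, φ d ∈ S) → (∀ d ∈ S, α d ∈ S) → S = Set.univ) :
    6 * Nat.card V ≤ Nat.card D + 12 ∧
    (6 * Nat.card V = Nat.card D + 12 → ∀ a b, src a = src b → (α * φ⁻¹).SameCycle a b) := by
  have hface : (α * φ⁻¹)⁻¹ * α = φ := by simp
  have h1 := euler_inequality (α * φ⁻¹) α hα hne
  rw [hface, numComp_eq_one (α * φ⁻¹) α (by rwa [hface])] at h1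
  have h2 := card_eq_two_mul α hα hne
  have h4 := card_eq_three_mul φ h3 hφ
  let r := Equiv.Perm.SameCycle.setoid (α * φ⁻¹)
  have hinv : ∀ d, src ((α * φ⁻¹) d) = src d := fun d => by
    rw [Equiv.Perm.mul_apply, hsrc]; simp
  let f : Quotient r → V := Quotient.lift src fun a b hab => invariant_of_sameCycle hinv hab
  have hf : Function.Surjective f := fun v => by
    obtain ⟨d, rfl⟩ := hsurj v
    exact ⟨Quotient.mk r d, rfl⟩
  have h5 : Nat.card V ≤ Nat.card (Quotient r) := Nat.card_le_card_of_surjective f hf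
  have h6 : numOrbits (α * φ⁻¹) = Nat.card (Quotient r) := rfl
  refine ⟨by omega, fun h a b hab => ?_⟩
  have hbij : Function.Bijective f := by
    rw [Nat.bijective_iff_surjective_and_card]
    exact ⟨hf, by omega⟩
  exact Quotient.exact (hbij.1 (show f (Quotient.mk r a) = f (Quotient.mk r b) from hab))

end Euler

namespace IsTriangulation
variable {M : RotationSystem} (hM : M.IsTriangulation)
include hM

lemma face_ne (d : M.Dart) : M.face d ≠ d := fun h => by
  have := M.src_face d
  rw [h] at this
  exact hM.loopless d this

lemma exists_dart (v : M.Vert) : ∃ d, M.src d = v := by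
  have : Nontrivial M.Vert := Finite.one_lt_card_iff_nontrivial.1 (by have := hM.three_le; omega)
  obtain ⟨w, hw⟩ := exists_ne v
  rcases ReflTransGen.cases_head (hM.connected v w) with h | ⟨u, ⟨d, hd, -⟩, -⟩
  · exact absurd h hw.symm
  · exact ⟨d, hd⟩

lemma nonempty_dart : Nonempty M.Dart := by
  have : 0 < Nat.card M.Vert := by have := hM.three_le; omega
  obtain ⟨v⟩ := (Nat.card_pos_iff.1 this).1
  obtain ⟨d, -⟩ := hM.exists_dart v
  exact ⟨d⟩

/-- A triangulation cannot be split into two sets of faces without a common edge. -/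
lemma eq_univ_of_closed (S : Set M.Dart) (hS : S.Nonempty) (hf : ∀ d ∈ S, M.face d ∈ S)
    (hr : ∀ d ∈ S, M.rev d ∈ S) : S = Set.univ := by
  have hrot : ∀ d ∈ S, M.rot d ∈ S := by
    intro d hd
    have h := hr _ (hf _ (hf _ hd))
    rwa [← M.rot_face, hM.triangular] at h
  have hv : ∀ a b, M.src a = M.src b → a ∈ S → b ∈ S := by
    intro a b hab ha
    have := M.eq_of_src_eq (v := M.src a) (g := fun d => d ∈ S) (fun d _ => ?_) rfl hab.symm
    · exact this ▸ ha
    · refine propext ⟨fun h => ?_, hrot d⟩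
      have := hf _ (hr _ h)
      rwa [M.face_rev_rot] at this
  obtain ⟨a, ha⟩ := hS
  have key : ∀ w, ReflTransGen M.Adjacent (M.src a) w → ∀ d, M.src d = w → d ∈ S := by
    intro w hw
    induction hw with
    | refl => exact fun d hd => hv a d hd.symm ha
    | tail _ h ih =>
      obtain ⟨e, he, rfl⟩ := h
      exact fun d hd => hv (M.rev e) d hd.symm (hr _ (ih e he))
  exact Set.eq_univ_of_forall fun d => key _ (hM.connected _ _) d rfl

lemma card_dart : Nat.card M.Dart + 12 = 6 * Nat.card M.Vert := by
  have := hM.nonempty_dart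
  have h1 : M.numComponents = 1 := numComp_eq_one M.rot M.rev hM.eq_univ_of_closed
  have h2 := card_eq_two_mul M.rev M.rev_rev M.rev_ne
  have h3 := card_eq_three_mul M.face hM.triangular hM.face_ne
  have h4 : numOrbits M.rot = Nat.card M.Vert := by
    refine Nat.card_eq_of_bijective (Quotient.lift M.src fun a b h => (M.rot_orbits a b).2 h)
      ⟨fun x y h => ?_, fun v => ?_⟩
    · induction x using Quotient.inductionOn with | _ a
      induction y using Quotient.inductionOn with | _ b
      exact Quotient.sound ((M.rot_orbits a b).1 h)
    · obtain ⟨d, rfl⟩ := hM.exists_dart v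
      exact ⟨Quotient.mk _ d, rfl⟩
  have := hM.planar
  rw [Planar, h1, h4] at this
  omega

end IsTriangulation

/-- A connected surface glued from triangles, with labels `src` of the right number for the vertices,
is a triangulation of the sphere. By the case of equality in Euler's inequality, it is not necessary
to check that darts with the same label lie in one orbit of the rotation. -/
lemma exists_triangulation {D V : Type} [Finite D] [Nonempty D] [Finite V] (φ α : Equiv.Perm D)
    (src : D → V) (hα : ∀ d, α (α d) = d) (h3 : ∀ d, φ (φ (φ d)) = d)
    (hloop : ∀ d, src d ≠ src (α d))
    (hsrc : ∀ d, src (α d) = src (φ d)) (hsurj : Function.Surjective src)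
    (htrans : ∀ S : Set D, S.Nonempty → (∀ d ∈ S, φ d ∈ S) → (∀ d ∈ S, α d ∈ S) → S = Set.univ)
    (hV : 3 ≤ Nat.card V) (hcard : 6 * Nat.card V = Nat.card D + 12) :
    ∃ (N : RotationSystem) (eV : V ≃ N.Vert) (eD : D ≃ N.Dart), N.IsTriangulation ∧
      (∀ d, N.src (eD d) = eV (src d)) ∧ (∀ d, N.rev (eD d) = eD (α d)) ∧
      (∀ d, N.face (eD d) = eD (φ d)) := by
  have hne : ∀ d, α d ≠ d := fun d h => hloop d (by rw [h])
  have hφ : ∀ d, φ d ≠ d := fun d h => hloop d (by rw [hsrc, h])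
  have key := (six_mul_card_le φ α src hα hne h3 hφ hsrc hsurj htrans).2 hcard
  have hinv : ∀ d, src ((α * φ⁻¹) d) = src d := fun d => by
    rw [Equiv.Perm.mul_apply, hsrc]; simp
  let N : RotationSystem :=
    { Vert := V
      Dart := D
      src := src
      rev := α
      rot := α * φ⁻¹
      rev_rev := hα
      rev_ne := hne
      rot_orbits := fun a b => ⟨key a b, fun h => invariant_of_sameCycle hinv h⟩ }
  have hface : N.face = φ := by simp [face, N]
  refine ⟨N, Equiv.refl _, Equiv.refl _, ?_, fun d => rfl, fun d => rfl, fun d => by simp [hface]⟩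
  have hconn : ∀ u v, ReflTransGen N.Adjacent u v := by
    intro u v
    obtain ⟨a, rfl⟩ := hsurj u
    obtain ⟨b, rfl⟩ := hsurj v
    have hS := htrans {d | ReflTransGen N.Adjacent (src a) (src d)} ⟨a, ReflTransGen.refl⟩
      (fun d hd => ReflTransGen.tail hd ⟨d, rfl, hsrc d⟩)
      (fun d hd => ReflTransGen.tail hd ⟨d, rfl, rfl⟩)
    exact (hS ▸ Set.mem_univ b : b ∈ {d | ReflTransGen N.Adjacent (src a) (src d)})
  refine ⟨?_, hV, hconn, hloop, by rw [hface]; exact h3⟩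
  have h1 : N.numComponents = 1 :=
    numComp_eq_one N.rot N.rev (by change ∀ S : Set D, _ → (∀ d ∈ S, N.face d ∈ S) → _; rw [hface]; exact htrans)
  have h2 := card_eq_two_mul α hα hne
  have h4 := card_eq_three_mul φ h3 hφ
  have h5 : numOrbits N.rot = Nat.card V := by
    refine Nat.card_eq_of_bijective (Quotient.lift src fun a b h => (N.rot_orbits a b).2 h)
      ⟨fun x y h => ?_, fun v => ?_⟩
    · induction x using Quotient.inductionOn with | _ a
      induction y using Quotient.inductionOn with | _ b
      exact Quotient.sound ((N.rot_orbits a b).1 h)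
    · obtain ⟨d, rfl⟩ := hsurj v
      exact ⟨Quotient.mk _ d, rfl⟩
  have h6 : numOrbits N.rev = numOrbits α := rfl
  rw [Planar, h1, hface, h5, h6]
  omega

/-! ### Wheels and their complements -/

/-- The darts in the faces at the center of a wheel: the spokes, the edges of the cycle (in the
direction of `rim`) and the reversed spokes. -/
def hub (M : RotationSystem) {k : ℕ} (s : Fin k → M.Dart) : Set M.Dart :=
  {d | ∃ i, d = s i ∨ d = M.rim s i ∨ d = M.rev (s i)}

namespace IsWheel
variable {M : RotationSystem} {k : ℕ} [NeZero k] {s : Fin k → M.Dart} (hs : M.IsWheel s)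
include hs

lemma src_spoke (i : Fin k) : M.src (s i) = M.src (s 0) := by
  have h : ∀ n : ℕ, M.src (s (Fin.ofNat k n)) = M.src (s 0) := by
    intro n
    induction n with
    | zero => rfl
    | succ n ih =>
      have e : Fin.ofNat k (n + 1) = Fin.ofNat k n + 1 := by
        ext; simp [Fin.val_add]
      rw [e, ← hs.rot_spoke, M.src_rot, ih]
  have := h i
  rwa [Fin.ofNat_val_eq_self] at this

lemma face_rim (i : Fin k) : M.face (M.rim s i) = M.rev (s (i + 1)) := by
  have h := M.rot_face (M.face (M.face (s i)))
  rw [hs.triangle, hs.rot_spoke] at h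
  exact M.rev_inj h.symm

lemma face_rev_spoke (i : Fin k) : M.face (M.rev (s (i + 1))) = s i := by
  rw [← hs.rot_spoke, M.face_rev_rot]

omit [NeZero k] hs in
lemma src_rim (s : Fin k → M.Dart) (i : Fin k) : M.src (M.rim s i) = M.tgt (s i) := M.src_face _

lemma tgt_rim (i : Fin k) : M.tgt (M.rim s i) = M.tgt (s (i + 1)) := by
  rw [← M.src_face, hs.face_rim, M.src_rev]

lemma spoke_injective : Function.Injective s := fun i j h =>
  hs.tgt_injective (by simp only [h])

lemma rim_injective : Function.Injective (M.rim s) := fun _ _ h =>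
  hs.spoke_injective (M.face.injective h)

lemma exists_spoke {d : M.Dart} (hd : M.src d = M.src (s 0)) : ∃ i, d = s i := by
  have := M.eq_of_src_eq (v := M.src (s 0)) (g := fun d => ∃ i, d = s i) (a := s 0) (b := d)
    (fun d _ => propext ⟨?_, ?_⟩) rfl hd
  · exact this ▸ ⟨0, rfl⟩
  · rintro ⟨i, hi⟩
    refine ⟨i - 1, M.rot.injective ?_⟩
    rw [hs.rot_spoke, hi, sub_add_cancel]
  · rintro ⟨i, rfl⟩
    exact ⟨i + 1, hs.rot_spoke i⟩

lemma face_mem_hub {d : M.Dart} (hd : d ∈ M.hub s) : M.face d ∈ M.hub s := by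
  obtain ⟨i, rfl | rfl | rfl⟩ := hd
  · exact ⟨i, Or.inr (Or.inl rfl)⟩
  · exact ⟨i + 1, Or.inr (Or.inr (hs.face_rim i))⟩
  · refine ⟨i - 1, Or.inl ?_⟩
    have := hs.face_rev_spoke (i - 1)
    rwa [sub_add_cancel] at this

lemma avoids_of_notMem {d : M.Dart} (hd : d ∉ M.hub s) : M.Avoids (M.src (s 0)) d := by
  refine ⟨fun h => hd ?_, fun h => hd ?_⟩
  · obtain ⟨i, rfl⟩ := hs.exists_spoke h
    exact ⟨i, Or.inl rfl⟩
  · obtain ⟨i, hi⟩ := hs.exists_spoke (d := M.rev d) h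
    exact ⟨i, Or.inr (Or.inr (M.rev_inj hi))⟩

lemma eq_rim_of_avoids {d : M.Dart} (hd : M.Avoids (M.src (s 0)) d) (h : d ∈ M.hub s) :
    ∃ i, d = M.rim s i := by
  obtain ⟨i, rfl | rfl | rfl⟩ := h
  · exact absurd (hs.src_spoke i) hd.1
  · exact ⟨i, rfl⟩
  · exact absurd ((M.tgt_rev _).trans (hs.src_spoke i)) hd.2

lemma eq_rev_rim {d : M.Dart} (hd : d ∉ M.hub s) (h : M.rev d ∈ M.hub s) :
    ∃ i, d = M.rev (M.rim s i) := by
  have h1 := hs.avoids_of_notMem hd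
  obtain ⟨i, hi⟩ := hs.eq_rim_of_avoids (d := M.rev d) ⟨h1.2, by rw [M.tgt_rev]; exact h1.1⟩ h
  exact ⟨i, M.rev_inj hi⟩

variable (hM : M.IsTriangulation)
include hM

lemma tgt_ne (i : Fin k) : M.tgt (s i) ≠ M.src (s 0) := by
  rw [← hs.src_spoke i]; exact (hM.loopless _).symm

lemma face_mem_hub_iff {d : M.Dart} : M.face d ∈ M.hub s ↔ d ∈ M.hub s := by
  refine ⟨fun h => ?_, hs.face_mem_hub⟩
  have := hs.face_mem_hub (hs.face_mem_hub h)
  rwa [hM.triangular] at this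

lemma avoids_rim (i : Fin k) : M.Avoids (M.src (s 0)) (M.rim s i) :=
  ⟨by rw [src_rim]; exact hs.tgt_ne hM i, by rw [hs.tgt_rim]; exact hs.tgt_ne hM _⟩

lemma card_hub : Nat.card (M.hub s) = 3 * k := by
  have h : Function.Bijective (fun x : Fin 3 × Fin k =>
      (⟨![s x.2, M.rim s x.2, M.rev (s x.2)] x.1, by
        obtain ⟨j, i⟩ := x
        fin_cases j
        · exact ⟨i, Or.inl rfl⟩
        · exact ⟨i, Or.inr (Or.inl rfl)⟩
        · exact ⟨i, Or.inr (Or.inr rfl)⟩⟩ : M.hub s)) := by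
    have h1 : ∀ i j, s i ≠ M.rim s j := fun i j h => (hs.avoids_rim hM j).1 (h ▸ hs.src_spoke i)
    have h2 : ∀ i j, M.rev (s i) ≠ M.rim s j := fun i j h =>
      (hs.avoids_rim hM j).2 (h ▸ (M.tgt_rev _).trans (hs.src_spoke i))
    have h3 : ∀ i j, M.rev (s i) ≠ s j := fun i j h =>
      hs.tgt_ne hM i ((congrArg M.src h).trans (hs.src_spoke j))
    constructor
    · rintro ⟨a, i⟩ ⟨b, j⟩ h
      have h := congrArg Subtype.val h
      fin_cases a <;> fin_cases b <;> simp at h ⊢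
      · exact hs.spoke_injective h
      · exact h1 _ _ h
      · exact h3 _ _ h.symm
      · exact h1 _ _ h.symm
      · exact hs.rim_injective h
      · exact h2 _ _ h.symm
      · exact h3 _ _ h
      · exact h2 _ _ h
      · exact hs.spoke_injective h
    · rintro ⟨d, i, rfl | rfl | rfl⟩
      · exact ⟨(0, i), rfl⟩
      · exact ⟨(1, i), rfl⟩
      · exact ⟨(2, i), rfl⟩
  rw [← Nat.card_eq_of_bijective _ h, Nat.card_prod]
  simp

lemma card_compl_hub : Nat.card {d // d ∉ M.hub s} + 3 * k = Nat.card M.Dart := by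
  rw [← hs.card_hub hM, add_comm]
  have := Set.ncard_add_ncard_compl (M.hub s)
  exact this

variable (hrim : ∀ i j, M.rev (M.rim s i) ≠ M.rim s j)
include hrim

lemma rev_rim_notMem (i : Fin k) : M.rev (M.rim s i) ∉ M.hub s := by
  rintro ⟨j, h | h | h⟩
  · exact (hs.avoids_rim hM i).2 ((congrArg M.src h).trans (hs.src_spoke j))
  · exact hrim i j h
  · exact (hs.avoids_rim hM i).1 (by rw [M.rev.injective h]; exact hs.src_spoke j)

/-- The faces outside a wheel are connected without crossing the cycle of the wheel. At a neighbour
of the center, a set `S` of such faces that is closed off the cycle has jumps only across the two edges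
of the cycle there, and these cancel; so `S` borders all of the cycle or nothing of it. -/
lemma eq_compl_hub (S : Set M.Dart) (hne : S.Nonempty) (hsub : S ⊆ (M.hub s)ᶜ)
    (hf : ∀ d ∈ S, M.face d ∈ S) (hr : ∀ d ∈ S, M.rev d ∉ M.hub s → M.rev d ∈ S) :
    S = (M.hub s)ᶜ := by
  classical
  cases nonempty_fintype M.Dart
  have hf' : ∀ d, M.face d ∈ S ↔ d ∈ S := fun d => ⟨fun h => by
    have := hf _ (hf _ h)
    rwa [hM.triangular] at this, hf d⟩
  have hstep : ∀ i, M.rev (M.rim s (i + 1)) ∈ S ↔ M.rev (M.rim s i) ∈ S := by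
    intro i
    let φ : M.Dart → ℚ := fun d => if d ∈ S then 1 else 0
    have h1 := M.vertex_sum_jump φ (fun d => by simp [φ, hf']) (M.tgt (s (i + 1)))
    have hrimS : ∀ j, M.rim s j ∉ S := fun j h => hsub h ⟨j, Or.inr (Or.inl rfl)⟩
    rw [← Finset.sum_subset (s₁ := {M.rim s (i + 1), M.rev (M.rim s i)}),
      Finset.sum_pair (hrim i (i + 1)).symm, M.rev_rev] at h1
    · simp only [φ, hrimS, if_false] at h1
      by_cases h2 : M.rev (M.rim s (i + 1)) ∈ S <;> by_cases h3 : M.rev (M.rim s i) ∈ S <;>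
        simp_all
    · intro d hd
      rw [Finset.mem_insert, Finset.mem_singleton] at hd
      rw [Finset.mem_filter]
      refine ⟨Finset.mem_univ _, ?_⟩
      rcases hd with rfl | rfl
      · exact src_rim s _
      · exact hs.tgt_rim i
    · intro d hd hd'
      rw [Finset.mem_filter] at hd
      rw [Finset.mem_insert, Finset.mem_singleton, not_or] at hd'
      suffices h : d ∈ S ↔ M.rev d ∈ S by simp [φ, h]
      constructor
      · intro h
        refine hr d h fun h' => ?_
        obtain ⟨j, rfl⟩ := hs.eq_rev_rim (hsub h) h'
        have : j + 1 = i + 1 := hs.tgt_injective ((hs.tgt_rim j).symm.trans hd.2)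
        exact hd'.2 (by rw [add_right_cancel this])
      · intro h
        have h0 := hr _ h
        rw [M.rev_rev] at h0
        refine h0 fun h' => ?_
        obtain ⟨j, hj⟩ := hs.eq_rev_rim (hsub h) (by rwa [M.rev_rev])
        obtain rfl := M.rev.injective hj
        have : j = i + 1 := hs.tgt_injective ((src_rim s j).symm.trans hd.2)
        exact hd'.1 (by rw [this])
  have hall : ∀ i, M.rev (M.rim s i) ∈ S ↔ M.rev (M.rim s 0) ∈ S := by
    have h : ∀ n : ℕ, M.rev (M.rim s (Fin.ofNat k n)) ∈ S ↔ M.rev (M.rim s 0) ∈ S := by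
      intro n
      induction n with
      | zero => rfl
      | succ n ih =>
        have e : Fin.ofNat k (n + 1) = Fin.ofNat k n + 1 := by
          ext; simp [Fin.val_add]
        rw [e, hstep, ih]
    intro i
    have := h i
    rwa [Fin.ofNat_val_eq_self] at this
  by_cases h0 : M.rev (M.rim s 0) ∈ S
  · have := hM.eq_univ_of_closed (S ∪ M.hub s) (hne.mono Set.subset_union_left) ?_ ?_
    · refine hsub.antisymm fun d hd => ?_
      exact (Set.eq_univ_iff_forall.1 this d).resolve_right hd
    · rintro d (h | h)
      · exact Or.inl (hf d h)
      · exact Or.inr (hs.face_mem_hub h)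
    · rintro d (h | ⟨i, rfl | rfl | rfl⟩)
      · by_cases h' : M.rev d ∈ M.hub s
        · exact Or.inr h'
        · exact Or.inl (hr d h h')
      · exact Or.inr ⟨i, Or.inr (Or.inr rfl)⟩
      · exact Or.inl ((hall i).2 h0)
      · exact Or.inr ⟨i, Or.inl (M.rev_rev _)⟩
  · have := hM.eq_univ_of_closed S hne hf fun d hd => hr d hd fun h => ?_
    · exact absurd (⟨0, Or.inl rfl⟩ : s 0 ∈ M.hub s) (hsub (Set.eq_univ_iff_forall.1 this _))
    · obtain ⟨i, rfl⟩ := hs.eq_rev_rim (hsub hd) h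
      exact h0 ((hall i).1 hd)

end IsWheel

/-! ### Surgery on a wheel -/

/-- Surgery on a wheel. The faces at the center are removed, and the resulting hole, whose boundary
darts are indexed by `Fin k`, is closed by new triangles: their darts form the type `X`, with face
permutation `ψ`, and the involution `ρ` of `Fin k ⊕ X` says which darts are glued. The vertices are
relabelled by `f`; the vertices of the new triangulation are the labels of the vertices other than the
center. The map `q` of darts keeps those outside and takes a dart of the cycle to the new partner of
its reverse. The merging relations are passed as parameters, to be chosen for each operation. -/
theorem IsWheel.exists_surgery {M : RotationSystem} {k : ℕ} [NeZero k] {s : Fin k → M.Dart}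
    (hs : M.IsWheel s) (hM : M.IsTriangulation) (hrim : ∀ i j, M.rev (M.rim s i) ≠ M.rim s j)
    {X : Type} [Finite X] (ψ : Equiv.Perm X) (hψ : ∀ x, ψ (ψ (ψ x)) = x)
    (ρ : Fin k ⊕ X → Fin k ⊕ X) (hρ : ∀ t, ρ (ρ t) = t)
    (hρX : ∀ x, ∃ i, ρ (Sum.inr x) = Sum.inl i)
    (f : M.Vert → M.Vert)
    (hf : ∀ d, M.Avoids (M.src (s 0)) d → f (M.src d) ≠ f (M.tgt d))
    (hfglue : ∀ i j, ρ (Sum.inl i) = Sum.inl j → f (M.tgt (s i)) = f (M.tgt (s (j + 1))))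
    (hfill : ∀ i j x, ρ (Sum.inl i) = Sum.inr x → ρ (Sum.inl j) = Sum.inr (ψ x) →
      f (M.tgt (s (i + 1))) = f (M.tgt (s j)))
    (h3 : 3 ≤ Nat.card {w // ∃ u, u ≠ M.src (s 0) ∧ f u = w})
    (hcard : 6 * Nat.card {w // ∃ u, u ≠ M.src (s 0) ∧ f u = w} + 3 * k =
      6 * Nat.card M.Vert + Nat.card X) :
    ∃ (N : RotationSystem) (g : M.Vert → N.Vert) (q : M.Dart → N.Dart), N.IsTriangulation ∧
      Nat.card N.Vert = Nat.card {w // ∃ u, u ≠ M.src (s 0) ∧ f u = w} ∧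
      (∀ idV idE, (∀ u v, u ≠ M.src (s 0) → v ≠ M.src (s 0) →
          (f u = f v ↔ u = v ∨ idV u v ∨ idV v u)) →
        (∀ d e, (idE d e ∨ idE e d) ↔ ∃ i j, ρ (Sum.inl i) = Sum.inl j ∧
          ((d = M.rim s i ∧ e = M.rev (M.rim s j)) ∨ (e = M.rim s i ∧ d = M.rev (M.rim s j)))) →
        IsDeletionQuotient M N (M.src (s 0)) idV idE g q) ∧
      KeepsFaces M N s q ∧
      ∀ i j x, ρ (Sum.inl i) = Sum.inr x → ρ (Sum.inl j) = Sum.inr (ψ x) →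
        N.face (q (M.rim s i)) = q (M.rim s j) := by
  classical
  let c := M.src (s 0)
  let H := M.hub s
  let V' := {w // ∃ u, u ≠ c ∧ f u = w}
  let K := {d // d ∉ H}
  have hrr : ∀ i, M.rev (M.rim s i) ∉ H := hs.rev_rim_notMem hM hrim
  -- the boundary darts, where the new faces are glued in
  let β : Fin k ⊕ X → K ⊕ X := Sum.map (fun i => ⟨M.rev (M.rim s i), hrr i⟩) id
  have hβ : ∀ i, β (Sum.inl i) = Sum.inl ⟨M.rev (M.rim s i), hrr i⟩ := fun i => rfl
  have hβX : ∀ x, β (Sum.inr x) = Sum.inr x := fun x => rfl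
  have hβinj : Function.Injective β := Sum.map_injective.2
    ⟨fun i j h => hs.rim_injective (M.rev.injective (congrArg Subtype.val h)),
      Function.injective_id⟩
  have hcases : ∀ y : K ⊕ X, (∃ t, y = β t) ∨
      ∃ (d : M.Dart) (h : d ∉ H), M.rev d ∉ H ∧ y = Sum.inl ⟨d, h⟩ := by
    rintro (⟨d, hd⟩ | x)
    · by_cases h : M.rev d ∈ H
      · obtain ⟨i, rfl⟩ := hs.eq_rev_rim hd h
        exact Or.inl ⟨Sum.inl i, rfl⟩
      · exact Or.inr ⟨d, hd, h, rfl⟩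
    · exact Or.inl ⟨Sum.inr x, rfl⟩
  have hβK : ∀ t d (h : d ∉ H), β t = Sum.inl ⟨d, h⟩ → M.rev d ∈ H := by
    rintro (i | x) d h e
    · obtain rfl : M.rev (M.rim s i) = d := congrArg Subtype.val (Sum.inl.inj e)
      rw [M.rev_rev]
      exact ⟨i, Or.inr (Or.inl rfl)⟩
    · cases e
  obtain ⟨r, hrβ, hrK⟩ : ∃ r : K ⊕ X → K ⊕ X, (∀ t, r (β t) = β (ρ t)) ∧
      ∀ d (h : d ∉ H) (h' : M.rev d ∉ H), r (Sum.inl ⟨d, h⟩) = Sum.inl ⟨M.rev d, h'⟩ := by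
    have : ∀ y : K ⊕ X, ∃ z : K ⊕ X, (∀ t, y = β t → z = β (ρ t)) ∧
        ∀ d (h : d ∉ H) (h' : M.rev d ∉ H), y = Sum.inl ⟨d, h⟩ → z = Sum.inl ⟨M.rev d, h'⟩ := by
      intro y
      rcases hcases y with ⟨t, rfl⟩ | ⟨d, h, h', rfl⟩
      · exact ⟨β (ρ t), fun t' e => by rw [hβinj e], fun d h h' e => absurd (hβK t d h e) h'⟩
      · refine ⟨Sum.inl ⟨M.rev d, h'⟩, fun t e => absurd (hβK t d h e.symm) h', ?_⟩
        intro d' _ _ e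
        obtain rfl : d = d' := congrArg Subtype.val (Sum.inl.inj e)
        rfl
    choose r h1 h2 using this
    exact ⟨r, fun t => h1 _ t rfl, fun d h h' => h2 _ d h h' rfl⟩
  have hrr' : ∀ y, r (r y) = y := by
    intro y
    rcases hcases y with ⟨t, rfl⟩ | ⟨d, h, h', rfl⟩
    · rw [hrβ, hrβ, hρ]
    · rw [hrK d h h', hrK _ h' (by rwa [M.rev_rev])]
      simp only [M.rev_rev]
  let α : Equiv.Perm (K ⊕ X) := Function.Involutive.toPerm r hrr'
  let φ : Equiv.Perm (K ⊕ X) :=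
    Equiv.sumCongr (M.face.subtypePerm fun d => not_congr (hs.face_mem_hub_iff hM)) ψ
  have hφK : ∀ d (h : d ∉ H), φ (Sum.inl ⟨d, h⟩) =
      Sum.inl ⟨M.face d, fun h' => h ((hs.face_mem_hub_iff hM).1 h')⟩ := fun d h => rfl
  have hφX : ∀ x, φ (Sum.inr x) = Sum.inr (ψ x) := fun x => rfl
  -- the index of the cycle edge along which a new dart is attached
  choose ι hι using hρX
  have hι' : ∀ x, ρ (Sum.inl (ι x)) = Sum.inr x := fun x => by rw [← hι, hρ]
  let src' : K ⊕ X → V' := Sum.elim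
    (fun d => ⟨f (M.src d), _, (hs.avoids_of_notMem d.2).1, rfl⟩)
    (fun x => ⟨f (M.tgt (s (ι x))), _, hs.tgt_ne hM _, rfl⟩)
  have hsβ : ∀ i, (src' (β (Sum.inl i))).1 = f (M.tgt (s (i + 1))) := fun i =>
    congrArg f (hs.tgt_rim i)
  -- the new start of the dart that corresponds to a dart of the cycle
  have hsρ : ∀ i, (src' (β (ρ (Sum.inl i)))).1 = f (M.tgt (s i)) := by
    intro i
    rcases h : ρ (Sum.inl i) with j | x
    · rw [hsβ, hfglue i j h]
    · have : ι x = i := by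
        have := hι' x
        rw [← h] at this
        have := congrArg ρ this
        rw [hρ, hρ] at this
        exact Sum.inl.inj this
      rw [← this]
      rfl
  have hne : Nonempty (K ⊕ X) := ⟨β (Sum.inl 0)⟩
  have hφ3 : ∀ y, φ (φ (φ y)) = y := by
    rintro (⟨d, hd⟩ | x)
    · rw [hφK, hφK, hφK]
      simp only [hM.triangular]
    · rw [hφX, hφX, hφX, hψ]
  have hloop : ∀ y, src' y ≠ src' (α y) := by
    have key : ∀ i, src' (β (Sum.inl i)) ≠ src' (r (β (Sum.inl i))) := fun i h => by
      have h := congrArg Subtype.val h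
      rw [hrβ, hsβ, hsρ] at h
      refine hf (M.rim s i) (hs.avoids_rim hM i) ?_
      rw [src_rim, hs.tgt_rim, h]
    intro y
    change src' y ≠ src' (r y)
    rcases hcases y with ⟨i | x, rfl⟩ | ⟨d, h, h', rfl⟩
    · exact key i
    · have e : β (Sum.inr x) = r (β (Sum.inl (ι x))) := by rw [hrβ, hι']
      rw [e, hrr']
      exact (key _).symm
    · rw [hrK d h h']
      exact fun e => hf d (hs.avoids_of_notMem h) (congrArg Subtype.val e)
  have hsrcφ : ∀ y, src' (α y) = src' (φ y) := by
    intro y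
    change src' (r y) = src' (φ y)
    rcases hcases y with ⟨i | x, rfl⟩ | ⟨d, h, h', rfl⟩
    · apply Subtype.ext
      rw [hrβ, hsρ, hβ, hφK]
      change _ = f (M.src (M.face (M.rev (M.rim s i))))
      rw [M.src_face, M.tgt_rev, src_rim]
    · apply Subtype.ext
      rw [hrβ, hι, hsβ, hβX, hφX]
      exact hfill _ _ x (hι' x) (hι' _)
    · rw [hrK d h h', hφK]
      exact Subtype.ext (congrArg f (M.src_face d).symm)
  have hsurj : Function.Surjective src' := by
    rintro ⟨w, u, hu, rfl⟩
    obtain ⟨d, rfl⟩ := hM.exists_dart u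
    by_cases hd : d ∈ H
    · have : ∃ i, M.src d = M.tgt (s i) := by
        obtain ⟨i, rfl | rfl | rfl⟩ := hd
        · exact absurd (hs.src_spoke i) hu
        · exact ⟨i, src_rim s i⟩
        · exact ⟨i, rfl⟩
      obtain ⟨i, hi⟩ := this
      refine ⟨β (ρ (Sum.inl i)), Subtype.ext ?_⟩
      exact (hsρ i).trans (congrArg f hi.symm)
    · exact ⟨Sum.inl ⟨d, hd⟩, rfl⟩
  have htrans : ∀ S : Set (K ⊕ X), S.Nonempty → (∀ y ∈ S, φ y ∈ S) → (∀ y ∈ S, α y ∈ S) →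
      S = Set.univ := by
    intro S hS hSf hSr
    have hSr : ∀ y ∈ S, r y ∈ S := hSr
    let S₀ : Set M.Dart := {d | ∃ h : d ∉ H, (Sum.inl ⟨d, h⟩ : K ⊕ X) ∈ S}
    have hX : ∀ x, Sum.inr x ∈ S → M.rev (M.rim s (ι x)) ∈ S₀ := fun x hx => by
      have := hSr _ hx
      rw [← hβX, hrβ, hι, hβ] at this
      exact ⟨hrr _, this⟩
    have h0 := hs.eq_compl_hub hM hrim S₀ ?_ (fun d hd => hd.1) ?_ ?_
    · have hK : ∀ d (h : d ∉ H), Sum.inl ⟨d, h⟩ ∈ S := fun d h => by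
        have : d ∈ S₀ := h0 ▸ h
        exact this.2
      refine Set.eq_univ_of_forall ?_
      rintro (⟨d, hd⟩ | x)
      · exact hK d hd
      · have := hSr _ (hK _ (hrr (ι x)))
        rwa [← hβ, hrβ, hι', hβX] at this
    · obtain ⟨⟨d, hd⟩ | x, hy⟩ := hS
      · exact ⟨d, hd, hy⟩
      · exact ⟨_, hX x hy⟩
    · rintro d ⟨h, hd⟩
      have := hSf _ hd
      rw [hφK] at this
      exact ⟨_, this⟩
    · rintro d ⟨h, hd⟩ h'
      have := hSr _ hd
      rw [hrK d h h'] at this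
      exact ⟨_, this⟩
  have hcard' : 6 * Nat.card V' = Nat.card (K ⊕ X) + 12 := by
    have h1 := hs.card_compl_hub hM
    have h2 := hM.card_dart
    have h4 : Nat.card (K ⊕ X) = Nat.card {d // d ∉ M.hub s} + Nat.card X := Nat.card_sum
    change 6 * Nat.card V' + 3 * k = _ at hcard
    rw [h4]
    omega
  obtain ⟨N, eV, eD, hN, hsrc, hrev, hface⟩ :=
    exists_triangulation φ α src' hrr' hφ3 hloop hsrcφ hsurj htrans h3 hcard'
  let q : M.Dart → K ⊕ X := fun d =>
    if h : d ∉ H then Sum.inl ⟨d, h⟩ else if h : M.rev d ∉ H then r (Sum.inl ⟨M.rev d, h⟩)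
    else β (Sum.inl 0)
  have hqK : ∀ d (h : d ∉ H), q d = Sum.inl ⟨d, h⟩ := fun d h => dif_pos h
  have hqr : ∀ i, q (M.rim s i) = β (ρ (Sum.inl i)) := fun i => by
    have h1 : ¬ M.rim s i ∉ H := not_not.2 ⟨i, Or.inr (Or.inl rfl)⟩
    rw [← hrβ]
    exact (dif_neg h1).trans (dif_pos (hrr i))
  have hav : ∀ d, M.Avoids c d → d ∉ H ∨ ∃ i, d = M.rim s i := fun d hd => by
    by_cases h : d ∈ H
    · exact Or.inr (hs.eq_rim_of_avoids hd h)
    · exact Or.inl h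
  refine ⟨N, fun u => if h : u ≠ c then eV ⟨f u, u, h, rfl⟩ else eV (src' (β (Sum.inl 0))),
    fun d => eD (q d), hN, (Nat.card_congr eV).symm, ?_, ?_, ?_⟩
  · intro idV idE hidV hidE
    refine ⟨?_, ?_, ?_, ?_, ?_, ?_⟩
    · intro w
      obtain ⟨⟨w, u, hu, rfl⟩, rfl⟩ := eV.surjective w
      exact ⟨u, hu, dif_pos hu⟩
    · intro u v hu hv
      rw [dif_pos hu, dif_pos hv, ← hidV u v hu hv, eV.apply_eq_iff_eq, Subtype.mk.injEq]
    · intro e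
      obtain ⟨y, rfl⟩ := eD.surjective e
      rcases y with ⟨d, hd⟩ | x
      · exact ⟨d, hs.avoids_of_notMem hd, by rw [hqK d hd]⟩
      · exact ⟨M.rim s (ι x), hs.avoids_rim hM _, by rw [hqr, hι', hβX]⟩
    · intro d e hd he
      have hS : ∀ i j, M.rim s i = M.rim s j ↔ i = j := fun i j => hs.rim_injective.eq_iff
      have hnr : ∀ d, d ∉ H → ∀ i, d ≠ M.rim s i := fun d h i e => h (e ▸ ⟨i, Or.inr (Or.inl rfl)⟩)
      have mixed : ∀ d (h : d ∉ H) j, q d = q (M.rim s j) ↔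
          ∃ i, ρ (Sum.inl j) = Sum.inl i ∧ d = M.rev (M.rim s i) := by
        intro d h j
        rw [hqK d h, hqr]
        rcases ρ (Sum.inl j) with i | x
        · rw [hβ, Sum.inl.injEq, Subtype.mk.injEq]
          simp
        · rw [hβX]; simp
      rw [hidE, eD.apply_eq_iff_eq]
      rcases hav d hd with hd' | ⟨i, rfl⟩ <;> rcases hav e he with he' | ⟨j, rfl⟩
      · rw [hqK d hd', hqK e he', Sum.inl.injEq, Subtype.mk.injEq]
        refine ⟨Or.inl, ?_⟩
        rintro (h | ⟨i, j, -, ⟨h, -⟩ | ⟨h, -⟩⟩)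
        · exact h
        · exact absurd h (hnr d hd' i)
        · exact absurd h (hnr e he' i)
      · rw [mixed d hd' j]
        constructor
        · rintro ⟨i, h1, h2⟩
          exact Or.inr ⟨j, i, h1, Or.inr ⟨rfl, h2⟩⟩
        · rintro (h | ⟨i, l, h0, ⟨h, -⟩ | ⟨h, h'⟩⟩)
          · exact absurd h (hnr d hd' j)
          · exact absurd h (hnr d hd' i)
          · obtain rfl := (hS _ _).1 h
            exact ⟨l, h0, h'⟩
      · rw [eq_comm, mixed e he' i]
        constructor
        · rintro ⟨j, h1, h2⟩
          exact Or.inr ⟨i, j, h1, Or.inl ⟨rfl, h2⟩⟩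
        · rintro (h | ⟨j, l, h0, ⟨h, h'⟩ | ⟨h, -⟩⟩)
          · exact absurd h.symm (hnr e he' i)
          · obtain rfl := (hS _ _).1 h
            exact ⟨l, h0, h'⟩
          · exact absurd h (hnr e he' j)
      · rw [hqr, hqr, hβinj.eq_iff]
        constructor
        · intro h
          have := congrArg ρ h
          rw [hρ, hρ] at this
          exact Or.inl (by rw [Sum.inl.inj this])
        · rintro (h | ⟨l, m, -, ⟨-, h⟩ | ⟨-, h⟩⟩)
          · rw [(hS _ _).1 h]
          · exact absurd h.symm (hrim _ _)
          · exact absurd h.symm (hrim _ _)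
    · intro d hd
      rw [hsrc, dif_pos hd.1, eV.apply_eq_iff_eq]
      rcases hav d hd with hd' | ⟨i, rfl⟩
      · rw [hqK d hd']
        rfl
      · rw [hqr]
        exact Subtype.ext (by rw [hsρ]; exact congrArg f (src_rim s i).symm)
    · intro d hd
      rw [hrev, eD.apply_eq_iff_eq]
      change r (q d) = q (M.rev d)
      rcases hav d hd with hd' | ⟨i, rfl⟩
      · by_cases h : M.rev d ∈ H
        · obtain ⟨i, rfl⟩ := hs.eq_rev_rim hd' h
          rw [hqK _ hd', M.rev_rev, hqr, ← hrβ, hβ]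
        · rw [hqK d hd', hqK _ h, hrK d hd' h]
      · rw [hqr, hrβ, hρ, hqK _ (hrr i), hβ]
  · intro d hd hd'
    have h : d ∉ H := (hav d hd).resolve_right fun ⟨i, hi⟩ => hd' i hi
    change N.face (eD (q d)) = eD (q (M.face d))
    rw [hface, hqK d h, hφK, hqK]
  · intro i j x h1 h2
    change N.face (eD (q (M.rim s i))) = eD (q (M.rim s j))
    rw [hface, hqr, hqr, h1, h2, hβX, hβX, hφX]

lemma card_image_id {V : Type} [Finite V] (c : V) :
    Nat.card {w : V // ∃ u, u ≠ c ∧ id u = w} + 1 = Nat.card V := by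
  have h : {w : V | ∃ u, u ≠ c ∧ id u = w} = {c}ᶜ := by ext w; simp
  have h1 := Set.ncard_add_ncard_compl ({c} : Set V)
  rw [Set.ncard_singleton, ← h] at h1
  rw [add_comm]
  exact h1

open Classical in
lemma card_image_update {V : Type} [Finite V] {c y z : V} (hyc : y ≠ c) (hzc : z ≠ c)
    (hyz : y ≠ z) :
    Nat.card {w : V // ∃ u, u ≠ c ∧ Function.update id z y u = w} + 2 = Nat.card V := by
  have h : {w : V | ∃ u, u ≠ c ∧ Function.update id z y u = w} = {c, z}ᶜ := by
    ext w
    simp only [Set.mem_ofPred_eq, Set.mem_compl_iff, Set.mem_insert_iff, Set.mem_singleton_iff, not_or]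
    constructor
    · rintro ⟨u, hu, rfl⟩
      by_cases h : u = z
      · subst h
        rw [Function.update_self]
        exact ⟨hyc, hyz⟩
      · rw [Function.update_of_ne h]
        exact ⟨hu, h⟩
    · rintro ⟨h1, h2⟩
      exact ⟨w, h1, Function.update_of_ne h2 _ _⟩
  have h1 := Set.ncard_add_ncard_compl ({c, z} : Set V)
  rw [Set.ncard_pair hzc.symm, ← h] at h1
  rw [add_comm]
  exact h1

open Classical in
/-- `Function.update id z y` identifies `z` with `y` and nothing else. -/
lemma update_id_eq_iff {V : Type} {y z : V} (hyz : y ≠ z) (u v : V) :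
    Function.update id z y u = Function.update id z y v ↔
      u = v ∨ (u = y ∧ v = z) ∨ (v = y ∧ u = z) := by
  grind [Function.update_apply]

/-- In a wheel with more than two spokes, no edge of the cycle occurs in both directions. -/
lemma IsWheel.rev_rim_ne {M : RotationSystem} {k : ℕ} [NeZero k] {s : Fin k → M.Dart}
    (hs : M.IsWheel s) (h2 : (1 + 1 : Fin k) ≠ 0) (i j : Fin k) :
    M.rev (M.rim s i) ≠ M.rim s j := fun h => by
  have h1 : i + 1 = j := hs.tgt_injective <| by
    change M.tgt (s (i + 1)) = M.tgt (s j)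
    rw [← hs.tgt_rim, ← src_rim s j, ← h, M.src_rev]
  have h3 : i = j + 1 := hs.tgt_injective <| by
    change M.tgt (s i) = M.tgt (s (j + 1))
    rw [← hs.tgt_rim, ← src_rim, ← h, M.tgt_rev]
  rw [← h1, add_assoc] at h3
  exact h2 (left_eq_add.1 h3)

/-! ### The four contracting operations -/

namespace IsTriangulation
variable {M : RotationSystem} (hM : M.IsTriangulation)
include hM

lemma exists_contract2 {s : Fin 2 → M.Dart} (hs : M.IsWheel s)
    (hrim : M.rim s 1 ≠ M.rev (M.rim s 0)) (h4 : 4 ≤ Nat.card M.Vert) :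
    ∃ N : RotationSystem, N.IsTriangulation ∧ Contract2 M N ∧
      Nat.card N.Vert < Nat.card M.Vert := by
  have hc := card_image_id (M.src (s 0))
  obtain ⟨N, g, q, hN, hcN, hq, hk, -⟩ := hs.exists_surgery hM (X := Empty) (f := id)
    (fun i j => by
      fin_cases i <;> fin_cases j
      · exact M.rev_ne _
      · exact hrim.symm
      · exact fun h => hrim (M.rev_inj h)
      · exact M.rev_ne _)
    1 (fun x => rfl) (Sum.elim (fun i => Sum.inl (i + 1)) Sum.inr)
    (by rintro (i | x) <;> [(fin_cases i <;> rfl); rfl]) (by simp)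
    (fun d _ => hM.loopless d)
    (by
      intro i j h
      obtain rfl : i + 1 = j := Sum.inl.inj h
      fin_cases i <;> rfl)
    (by simp) (by omega) (by rw [Nat.card_of_isEmpty (α := Empty)]; omega)
  refine ⟨N, hN, ⟨s, hs, hrim, g, q, hq _ _ (by simp) ?_, hk⟩, by omega⟩
  intro d e
  simp only [Merged, Sum.elim_inl, Sum.inl.injEq, Fin.exists_fin_two]
  simp
  tauto

lemma exists_contract3 {s : Fin 3 → M.Dart} (hs : M.IsWheel s) (h4 : 4 ≤ Nat.card M.Vert) :
    ∃ N : RotationSystem, N.IsTriangulation ∧ Contract3 M N ∧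
      Nat.card N.Vert < Nat.card M.Vert := by
  have hc := card_image_id (M.src (s 0))
  obtain ⟨N, g, q, hN, hcN, hq, hk, hfc⟩ := hs.exists_surgery hM (X := Fin 3) (f := id)
    (hs.rev_rim_ne (by decide))
    (Equiv.addRight 1) (by decide) (Sum.elim Sum.inr Sum.inl)
    (by rintro (i | x) <;> rfl) (fun x => ⟨x, rfl⟩)
    (fun d _ => hM.loopless d) (by simp)
    (by
      intro i j x h1 h2
      obtain rfl : i = x := Sum.inr.inj h1
      obtain rfl : j = i + 1 := Sum.inr.inj h2
      rfl) (by omega) (by rw [Nat.card_fin]; omega)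
  refine ⟨N, hN, ⟨s, hs, g, q, hq _ _ (by simp) (by simp), hk, ?_⟩, by omega⟩
  exact fun i => hfc i (i + 1) i rfl rfl

lemma exists_contract4 {s : Fin 4 → M.Dart} (hs : M.IsWheel s)
    (hnadj : ¬ M.Adjacent (M.tgt (s 0)) (M.tgt (s 2))) (h5 : 5 ≤ Nat.card M.Vert) :
    ∃ N : RotationSystem, N.IsTriangulation ∧ Contract4 M N ∧
      Nat.card N.Vert < Nat.card M.Vert := by
  classical
  have hne : M.tgt (s 0) ≠ M.tgt (s 2) := hs.tgt_injective.ne (by decide)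
  have hc := card_image_update (hs.tgt_ne hM 0) (hs.tgt_ne hM 2) hne
  have hid := update_id_eq_iff hne
  obtain ⟨N, g, q, hN, hcN, hq, hk, -⟩ := hs.exists_surgery hM (X := Empty)
    (f := Function.update id (M.tgt (s 2)) (M.tgt (s 0)))
    (hs.rev_rim_ne (by decide))
    1 (fun x => rfl) (Sum.elim (fun i => Sum.inl (![1, 0, 3, 2] i)) Sum.inr)
    (by rintro (i | x) <;> [(fin_cases i <;> rfl); rfl]) (by simp)
    (fun d _ => by
      rw [Ne, hid, not_or, not_or]
      exact ⟨hM.loopless d, fun h => hnadj ⟨d, h.1, h.2⟩,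
        fun h => hnadj ⟨M.rev d, h.1, by rw [M.tgt_rev]; exact h.2⟩⟩)
    (by
      intro i j h
      obtain rfl : ![1, 0, 3, 2] i = j := Sum.inl.inj h
      rw [hid]
      fin_cases i
      · exact Or.inr (Or.inl ⟨rfl, rfl⟩)
      · exact Or.inl rfl
      · exact Or.inr (Or.inr ⟨rfl, rfl⟩)
      · exact Or.inl rfl)
    (by simp) (by omega) (by rw [Nat.card_of_isEmpty (α := Empty)]; omega)
  refine ⟨N, hN, ⟨s, hs, hnadj, g, q, hq _ _ (fun u v _ _ => hid u v) ?_, hk⟩, by omega⟩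
  intro d e
  constructor
  · rintro (((⟨rfl, rfl⟩ | ⟨rfl, rfl⟩) | (⟨rfl, rfl⟩ | ⟨rfl, rfl⟩)) |
      ((⟨rfl, rfl⟩ | ⟨rfl, rfl⟩) | (⟨rfl, rfl⟩ | ⟨rfl, rfl⟩)))
    · exact ⟨0, 1, rfl, Or.inl ⟨rfl, rfl⟩⟩
    · exact ⟨1, 0, rfl, Or.inr ⟨rfl, rfl⟩⟩
    · exact ⟨2, 3, rfl, Or.inl ⟨rfl, rfl⟩⟩
    · exact ⟨3, 2, rfl, Or.inr ⟨rfl, rfl⟩⟩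
    · exact ⟨0, 1, rfl, Or.inr ⟨rfl, rfl⟩⟩
    · exact ⟨1, 0, rfl, Or.inl ⟨rfl, rfl⟩⟩
    · exact ⟨2, 3, rfl, Or.inr ⟨rfl, rfl⟩⟩
    · exact ⟨3, 2, rfl, Or.inl ⟨rfl, rfl⟩⟩
  · rintro ⟨i, j, h, h'⟩
    have hij : ∀ i j : Fin 4, ![1, 0, 3, 2] i = j →
        (i = 0 ∧ j = 1) ∨ (i = 1 ∧ j = 0) ∨ (i = 2 ∧ j = 3) ∨ (i = 3 ∧ j = 2) := by decide
    rcases hij i j (Sum.inl.inj h) with ⟨rfl, rfl⟩ | ⟨rfl, rfl⟩ | ⟨rfl, rfl⟩ | ⟨rfl, rfl⟩ <;>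
      rcases h' with h' | h'
    · exact Or.inl (Or.inl (Or.inl h'))
    · exact Or.inr (Or.inl (Or.inl h'))
    · exact Or.inr (Or.inl (Or.inr h'.symm))
    · exact Or.inl (Or.inl (Or.inr h'.symm))
    · exact Or.inl (Or.inr (Or.inl h'))
    · exact Or.inr (Or.inr (Or.inl h'))
    · exact Or.inr (Or.inr (Or.inr h'.symm))
    · exact Or.inl (Or.inr (Or.inr h'.symm))

lemma exists_contract5 {s : Fin 5 → M.Dart} (hs : M.IsWheel s)
    (hnadj : ¬ M.Adjacent (M.tgt (s 1)) (M.tgt (s 4))) (h5 : 5 ≤ Nat.card M.Vert) :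
    ∃ N : RotationSystem, N.IsTriangulation ∧ Contract5 M N ∧
      Nat.card N.Vert < Nat.card M.Vert := by
  classical
  have hne : M.tgt (s 1) ≠ M.tgt (s 4) := hs.tgt_injective.ne (by decide)
  have hc := card_image_update (hs.tgt_ne hM 1) (hs.tgt_ne hM 4) hne
  have hid := update_id_eq_iff hne
  let ρ : Fin 5 ⊕ Fin 3 → Fin 5 ⊕ Fin 3 :=
    Sum.elim ![Sum.inl 4, Sum.inr 0, Sum.inr 1, Sum.inr 2, Sum.inl 0]
      ![Sum.inl 1, Sum.inl 2, Sum.inl 3]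
  have hρl : ∀ i j, ρ (Sum.inl i) = Sum.inl j → (i = 0 ∧ j = 4) ∨ (i = 4 ∧ j = 0) := by decide
  have hρr : ∀ i j x, ρ (Sum.inl i) = Sum.inr x → ρ (Sum.inl j) = Sum.inr (Equiv.addRight 1 x) →
      (i + 1 = j) ∨ (i = 3 ∧ j = 1) := by decide
  obtain ⟨N, g, q, hN, hcN, hq, hk, hfc⟩ := hs.exists_surgery hM (X := Fin 3)
    (f := Function.update id (M.tgt (s 4)) (M.tgt (s 1)))
    (hs.rev_rim_ne (by decide))
    (Equiv.addRight 1) (by decide) ρ (by decide) (by decide)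
    (fun d _ => by
      rw [Ne, hid, not_or, not_or]
      exact ⟨hM.loopless d, fun h => hnadj ⟨d, h.1, h.2⟩,
        fun h => hnadj ⟨M.rev d, h.1, by rw [M.tgt_rev]; exact h.2⟩⟩)
    (by
      intro i j h
      rw [hid]
      rcases hρl i j h with ⟨rfl, rfl⟩ | ⟨rfl, rfl⟩
      · exact Or.inl rfl
      · exact Or.inr (Or.inr ⟨rfl, rfl⟩))
    (by
      intro i j x h1 h2
      rw [hid]
      rcases hρr i j x h1 h2 with rfl | ⟨rfl, rfl⟩
      · exact Or.inl rfl
      · exact Or.inr (Or.inr ⟨rfl, rfl⟩))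
    (by omega) (by rw [Nat.card_fin]; omega)
  refine ⟨N, hN, ⟨s, hs, hnadj, g, q, hq _ _ (fun u v _ _ => hid u v) ?_, hk, ?_⟩, by omega⟩
  · intro d e
    constructor
    · rintro ((⟨rfl, rfl⟩ | ⟨rfl, rfl⟩) | (⟨rfl, rfl⟩ | ⟨rfl, rfl⟩))
      · exact ⟨4, 0, rfl, Or.inl ⟨rfl, rfl⟩⟩
      · exact ⟨0, 4, rfl, Or.inr ⟨rfl, rfl⟩⟩
      · exact ⟨4, 0, rfl, Or.inr ⟨rfl, rfl⟩⟩
      · exact ⟨0, 4, rfl, Or.inl ⟨rfl, rfl⟩⟩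
    · rintro ⟨i, j, h, h'⟩
      rcases hρl i j h with ⟨rfl, rfl⟩ | ⟨rfl, rfl⟩ <;> rcases h' with h' | h'
      · exact Or.inr (Or.inr h'.symm)
      · exact Or.inl (Or.inr h'.symm)
      · exact Or.inl (Or.inl h')
      · exact Or.inr (Or.inl h')
  · exact ⟨hfc 1 2 0 rfl rfl, hfc 2 3 1 rfl rfl, hfc 3 1 2 rfl rfl⟩

end IsTriangulation

/-! ### Digons and vertices of low degree -/

section Spokes
variable (M : RotationSystem)

/-- The darts leaving a vertex, enumerated in cyclic order. -/
lemma exists_spokes {k : ℕ} [NeZero k] {v : M.Vert} (hk : Nat.card {d : M.Dart // M.src d = v} = k) :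
    ∃ s : Fin k → M.Dart, (∀ i, M.src (s i) = v) ∧ (∀ i, M.rot (s i) = s (i + 1)) ∧
      Function.Injective s := by
  classical
  cases nonempty_fintype M.Dart
  let T : Finset M.Dart := {d | M.src d = v}
  have hT : T.card = k := by
    rw [← hk, Nat.card_eq_fintype_card, Fintype.card_subtype]
  have hmem : ∀ d, d ∈ T ↔ M.src d = v := fun d => by simp [T]
  have hcyc : M.rot.IsCycleOn (T : Set M.Dart) := by
    refine ⟨⟨fun d hd => ?_, M.rot.injective.injOn, fun d hd => ?_⟩, fun a ha b hb => ?_⟩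
    · simpa [hmem, M.src_rot] using hd
    · refine ⟨M.rot⁻¹ d, ?_, by simp⟩
      have := M.src_rot (M.rot⁻¹ d)
      simp only [Finset.mem_coe, hmem] at hd ⊢
      rw [← this]
      simpa using hd
    · simp only [Finset.mem_coe, hmem] at ha hb
      exact (M.rot_orbits a b).1 (ha.trans hb.symm)
  obtain ⟨d₀, hd₀⟩ : T.Nonempty := by
    rw [← Finset.card_pos, hT]
    exact Nat.pos_of_ne_zero (NeZero.ne k)
  refine ⟨fun i => (M.rot ^ (i : ℕ)) d₀, fun i => ?_, fun i => ?_, fun i j h => ?_⟩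
  · have : ∀ n : ℕ, M.src ((M.rot ^ n) d₀) = v := by
      intro n
      induction n with
      | zero => exact (hmem _).1 hd₀
      | succ n ih => rw [pow_succ', Equiv.Perm.mul_apply, M.src_rot, ih]
    exact this i
  · rw [← Equiv.Perm.mul_apply, ← pow_succ', hcyc.pow_apply_eq_pow_apply hd₀, hT]
    simp [Fin.val_add, Nat.ModEq]
  · have := (hcyc.pow_apply_eq_pow_apply hd₀).1 h
    rw [hT] at this
    exact Fin.ext (Nat.ModEq.eq_of_lt_of_lt this i.2 j.2)

open Classical in
lemma card_mul_le (W : Set M.Vert) (n : ℕ)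
    (hW : ∀ v ∈ W, n ≤ Nat.card {d : M.Dart // M.src d = v}) :
    n * W.ncard ≤ {d | M.src d ∈ W}.ncard := by
  cases nonempty_fintype M.Dart
  cases nonempty_fintype M.Vert
  rw [Set.ncard_eq_toFinset_card', Set.ncard_eq_toFinset_card',
    Finset.card_eq_sum_card_fiberwise (f := M.src) (t := W.toFinset) (fun d hd => by simpa using hd)]
  rw [mul_comm, ← smul_eq_mul]
  refine Finset.card_nsmul_le_sum _ _ _ fun v hv => ?_
  have hv' : v ∈ W := by simpa using hv
  refine (hW v hv').trans (le_of_eq ?_)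
  rw [Nat.card_eq_fintype_card, Fintype.card_subtype]
  congr 1
  ext d
  simp only [Finset.mem_filter, Finset.mem_univ, true_and, Set.mem_toFinset, Set.mem_ofPred_eq]
  exact ⟨fun h => ⟨h ▸ hv', h⟩, fun h => h.2⟩

end Spokes

section Jump
variable {M : RotationSystem}

open Classical in
/-- The labels provided by `Planar.jordan` do not change across an edge off the walk, nor around a
vertex off the walk. -/
lemma jump_eq_of_notMem {φ : M.Dart → ℚ} {l : List M.Dart} (hφ : ∀ d, φ (M.face d) = φ d)
    (hjump : ∀ d, φ d - φ (M.rev d) = (l.count d : ℚ) - l.count (M.rev d)) :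
    (∀ d, d ∉ l → M.rev d ∉ l → φ (M.rev d) = φ d) ∧
    ∀ v, (∀ x ∈ l, M.src x ≠ v ∧ M.tgt x ≠ v) → ∀ d e, M.src d = v → M.src e = v → φ d = φ e := by
  have h1 : ∀ d, d ∉ l → M.rev d ∉ l → φ (M.rev d) = φ d := fun d h h' => by
    have := hjump d
    rw [List.count_eq_zero_of_not_mem h, List.count_eq_zero_of_not_mem h'] at this
    simp only [Nat.cast_zero, sub_self] at this
    linarith
  refine ⟨h1, fun v hv d e hd he => M.eq_of_src_eq (fun x hx => ?_) hd he⟩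
  have h2 : M.src (M.rot x) = v := by rw [M.src_rot, hx]
  rw [← h1 _ (fun h => (hv _ h).1 h2) (fun h => (hv _ h).2 (by rw [M.tgt_rev, h2])),
    ← hφ (M.rev _), M.face_rev_rot]

end Jump

/-- `I` consists of the darts of the faces on the left side of the closed walk formed by the two
parallel edges of `a` and `b`. -/
structure IsDigonSide (M : RotationSystem) (a b : M.Dart) (I : Set M.Dart) : Prop where
  src_eq : M.src b = M.tgt a
  tgt_eq : M.tgt b = M.src a
  face_mem : ∀ d, M.face d ∈ I ↔ d ∈ I
  left_mem : a ∈ I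
  right_mem : b ∈ I
  rev_left : M.rev a ∉ I
  rev_right : M.rev b ∉ I
  rev_mem : ∀ d ∈ I, d ≠ a → d ≠ b → M.rev d ∈ I

namespace IsDigonSide
variable {M : RotationSystem} {a b : M.Dart} {I : Set M.Dart} (hI : M.IsDigonSide a b I)
include hI

lemma compl : M.IsDigonSide (M.rev a) (M.rev b) Iᶜ where
  src_eq := by rw [M.src_rev, M.tgt_rev, hI.tgt_eq]
  tgt_eq := by rw [M.src_rev, M.tgt_rev, hI.src_eq]
  face_mem d := not_congr (hI.face_mem d)
  left_mem := hI.rev_left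
  right_mem := hI.rev_right
  rev_left := by rw [M.rev_rev]; exact not_not.2 hI.left_mem
  rev_right := by rw [M.rev_rev]; exact not_not.2 hI.right_mem
  rev_mem d hd ha hb h := hd <| by
    have := hI.rev_mem _ h (fun e => ha (M.rev_inj e)) (fun e => hb (M.rev_inj e))
    rwa [M.rev_rev] at this

/-- All faces at a vertex inside a digon are inside. -/
lemma interior_mem {v : M.Vert} (ha : v ≠ M.src a) (hb : v ≠ M.tgt a)
    (hv : ∃ d ∈ I, M.src d = v) (d : M.Dart) (hd : M.src d = v) : d ∈ I ∧ M.rev d ∈ I := by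
  have hrev : ∀ e, M.src e = v → (M.rev e ∈ I ↔ e ∈ I) := by
    intro e he
    constructor
    · intro h
      have := hI.rev_mem _ h (fun e' => hb ?_) (fun e' => ha ?_)
      · rwa [M.rev_rev] at this
      · rw [← he, M.rev_inj e', M.src_rev]
      · rw [← he, M.rev_inj e', M.src_rev, hI.tgt_eq]
    · intro h
      refine hI.rev_mem _ h (fun e' => ha ?_) (fun e' => hb ?_)
      · rw [← he, e']
      · rw [← he, e', hI.src_eq]
  obtain ⟨e, heI, he⟩ := hv
  have : (e ∈ I) = (d ∈ I) := M.eq_of_src_eq (g := fun d => d ∈ I)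
    (fun x hx => propext (by
      rw [← hrev _ (by rw [M.src_rot, hx]), ← hI.face_mem (M.rev _), M.face_rev_rot])) he hd
  have hdI : d ∈ I := this ▸ heI
  exact ⟨hdI, (hrev d hd).2 hdI⟩

variable (hM : M.IsTriangulation)
include hM

/-- The faces on one side of a digon are connected without crossing it. -/
lemma eq_of_closed {S : Set M.Dart} (hsub : S ⊆ I) (hne : S.Nonempty)
    (hf : ∀ d ∈ S, M.face d ∈ S) (hr : ∀ d ∈ S, M.rev d ∈ I → M.rev d ∈ S) : S = I := by
  classical
  cases nonempty_fintype M.Dart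
  have hf' : ∀ d, M.face d ∈ S ↔ d ∈ S := fun d => ⟨fun h => by
    have := hf _ (hf _ h)
    rwa [hM.triangular] at this, hf d⟩
  have hab : a ∈ S ↔ b ∈ S := by
    let φ : M.Dart → ℚ := fun d => if d ∈ S then 1 else 0
    have h1 := M.vertex_sum_jump φ (fun d => by simp [φ, hf']) (M.src a)
    have hne : a ≠ M.rev b := fun h => hI.rev_right (h ▸ hI.left_mem)
    have ha' : M.rev a ∉ S := fun h => hI.rev_left (hsub h)
    have hb' : M.rev b ∉ S := fun h => hI.rev_right (hsub h)
    rw [← Finset.sum_subset (s₁ := {a, M.rev b}), Finset.sum_pair hne, M.rev_rev] at h1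
    · simp only [φ, ha', hb', if_false] at h1
      by_cases h2 : a ∈ S <;> by_cases h3 : b ∈ S <;> simp_all
    · intro d hd
      rw [Finset.mem_insert, Finset.mem_singleton] at hd
      rw [Finset.mem_filter]
      refine ⟨Finset.mem_univ _, ?_⟩
      rcases hd with rfl | rfl
      · rfl
      · exact hI.tgt_eq
    · intro d hd hd'
      rw [Finset.mem_filter] at hd
      rw [Finset.mem_insert, Finset.mem_singleton, not_or] at hd'
      suffices h : d ∈ S ↔ M.rev d ∈ S by simp [φ, h]
      constructor
      · intro h
        refine hr d h (hI.rev_mem d (hsub h) hd'.1 fun e => hM.loopless a ?_)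
        rw [← hd.2, e, hI.src_eq]
      · intro h
        have := hr _ h
        rw [M.rev_rev] at this
        refine this ?_
        rw [← M.rev_rev d]
        refine hI.rev_mem _ (hsub h) (fun e => hM.loopless a ?_) fun e => hd'.2 (M.rev_inj e)
        rw [← hd.2, M.rev_inj e, M.src_rev]
  by_cases ha : a ∈ S
  · have := hM.eq_univ_of_closed (S ∪ Iᶜ) (hne.mono Set.subset_union_left) ?_ ?_
    · refine hsub.antisymm fun d hd => ?_
      exact (Set.eq_univ_iff_forall.1 this d).resolve_right (not_not.2 hd)
    · rintro d (h | h)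
      · exact Or.inl (hf d h)
      · exact Or.inr ((not_congr (hI.face_mem d)).2 h)
    · rintro d (h | h)
      · by_cases h' : M.rev d ∈ I
        · exact Or.inl (hr d h h')
        · exact Or.inr h'
      · by_cases h1 : d = M.rev a
        · subst h1
          rw [M.rev_rev]
          exact Or.inl ha
        · by_cases h2 : d = M.rev b
          · subst h2
            rw [M.rev_rev]
            exact Or.inl (hab.1 ha)
          · exact Or.inr (hI.compl.rev_mem d h h1 h2)
  · have := hM.eq_univ_of_closed S hne hf fun d hd => hr d hd ?_
    · exact absurd (hsub (Set.eq_univ_iff_forall.1 this (M.rev a))) hI.rev_left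
    · refine hI.rev_mem d (hsub hd) ?_ ?_
      · rintro rfl; exact ha hd
      · rintro rfl; exact ha (hab.2 hd)

/-- Euler's inequality for one side of a digon, closed to a sphere by gluing its two edges to each
other. -/
lemma six_mul_ncard_le : 6 * {v | ∃ d ∈ I, M.src d = v}.ncard ≤ I.ncard + 12 := by
  classical
  -- the reversal after gluing
  let r : M.Dart → M.Dart := fun d => if d = a then b else if d = b then a else M.rev d
  have hne : a ≠ b := fun h => hM.loopless a (by rw [← hI.src_eq, h])
  have hra : r a = b := by simp [r]
  have hrb : r b = a := by simp [r, hne.symm]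
  have hr' : ∀ d, d ≠ a → d ≠ b → r d = M.rev d := fun d h1 h2 => by simp [r, h1, h2]
  have hrI : ∀ d ∈ I, r d ∈ I := by
    intro d hd
    by_cases h1 : d = a
    · rw [h1, hra]; exact hI.right_mem
    · by_cases h2 : d = b
      · rw [h2, hrb]; exact hI.left_mem
      · rw [hr' d h1 h2]; exact hI.rev_mem d hd h1 h2
  have hrr : ∀ d ∈ I, r (r d) = d := by
    intro d hd
    by_cases h1 : d = a
    · rw [h1, hra, hrb]
    · by_cases h2 : d = b
      · rw [h2, hrb, hra]
      · rw [hr' d h1 h2, hr', M.rev_rev]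
        · rintro rfl; exact hI.rev_left (by rwa [M.rev_rev])
        · rintro rfl; exact hI.rev_right (by rwa [M.rev_rev])
  have hsrc : ∀ d ∈ I, M.src (r d) = M.tgt d ∧ M.src (r d) ≠ M.src d := by
    intro d hd
    by_cases h1 : d = a
    · rw [h1, hra]; exact ⟨hI.src_eq, by rw [hI.src_eq]; exact (hM.loopless a).symm⟩
    · by_cases h2 : d = b
      · rw [h2, hrb]; exact ⟨hI.tgt_eq.symm, by rw [hI.src_eq]; exact hM.loopless a⟩
      · rw [hr' d h1 h2]; exact ⟨rfl, (hM.loopless d).symm⟩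
  have : Nonempty I := ⟨⟨a, hI.left_mem⟩⟩
  refine (six_mul_card_le (D := I) (V := {v | ∃ d ∈ I, M.src d = v})
    (M.face.subtypePerm hI.face_mem)
    (Function.Involutive.toPerm (fun d => ⟨r d, hrI d d.2⟩) fun d => Subtype.ext (hrr d d.2))
    (fun d => ⟨M.src d, d, d.2, rfl⟩) (fun d => Subtype.ext (hrr d d.2)) ?_ ?_ ?_ ?_ ?_ ?_).1
  · exact fun d h => (hsrc d d.2).2 (congrArg M.src (congrArg Subtype.val h))
  · exact fun d => Subtype.ext (hM.triangular d)
  · exact fun d h => hM.face_ne d (congrArg Subtype.val h)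
  · exact fun d => Subtype.ext ((hsrc d d.2).1.trans (M.src_face d).symm)
  · rintro ⟨v, d, hd, rfl⟩
    exact ⟨⟨d, hd⟩, rfl⟩
  · intro S hS hSf hSr
    have key := hI.eq_of_closed hM (S := Subtype.val '' S) (by rintro _ ⟨d, -, rfl⟩; exact d.2)
      (hS.image _) (by rintro _ ⟨d, hd, rfl⟩; exact ⟨_, hSf d hd, rfl⟩) (by
        rintro _ ⟨d, hd, rfl⟩ h
        refine ⟨_, hSr d hd, ?_⟩
        refine hr' d ?_ ?_
        · intro e; rw [e] at h; exact hI.rev_left h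
        · intro e; rw [e] at h; exact hI.rev_right h)
    refine Set.eq_univ_of_forall fun d => ?_
    have : (d : M.Dart) ∈ Subtype.val '' S := key.ge d.2
    obtain ⟨e, he, h⟩ := this
    exact Subtype.ext h ▸ he

/-- Inside a digon there is a vertex of degree at most five: by Euler's inequality for the other side,
the inside has at most six darts per interior vertex, and two of them start on the digon. -/
lemma exists_degree_lt_six : ∃ v, v ≠ M.src a ∧ v ≠ M.tgt a ∧ (∃ d ∈ I, M.src d = v) ∧
    Nat.card {d : M.Dart // M.src d = v} < 6 := by
  by_contra hcon
  push Not at hcon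
  let W : Set M.Vert := {v | v ≠ M.src a ∧ v ≠ M.tgt a ∧ ∃ d ∈ I, M.src d = v}
  have h1 := M.card_mul_le W 6 fun v hv => hcon v hv.1 hv.2.1 hv.2.2
  have h2 : {d | M.src d ∈ W}.ncard < I.ncard := by
    refine Set.ncard_lt_ncard ⟨fun d hd => ?_, fun h => ?_⟩
    · exact (hI.interior_mem hd.1 hd.2.1 hd.2.2 d rfl).1
    · exact (h hI.left_mem).1 rfl
  have h3 := hI.compl.six_mul_ncard_le hM
  have h4 := Set.ncard_add_ncard_compl I
  have h5 := hM.card_dart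
  have h6 : Nat.card M.Vert ≤ W.ncard + {v | ∃ d ∈ Iᶜ, M.src d = v}.ncard := by
    rw [← Set.ncard_univ]
    refine le_trans (Set.ncard_le_ncard (fun v _ => ?_)) (Set.ncard_union_le _ _)
    by_contra h
    rw [Set.mem_union, not_or] at h
    have hI' : ∀ d, M.src d = v → d ∈ I := fun d hd => by
      by_contra h'
      exact h.2 ⟨d, h', hd⟩
    obtain ⟨d, hd⟩ := hM.exists_dart v
    refine h.1 ⟨?_, ?_, d, hI' d hd, hd⟩
    · rintro rfl
      exact hI.rev_right (hI' _ hI.tgt_eq)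
    · rintro rfl
      exact hI.rev_left (hI' _ rfl)
  omega

end IsDigonSide

namespace IsTriangulation
variable {M : RotationSystem} (hM : M.IsTriangulation)
include hM

/-- The Jordan curve theorem for two parallel edges. -/
lemma exists_digonSide {a b : M.Dart} (h1 : M.src b = M.tgt a) (h2 : M.tgt b = M.src a)
    (hne : b ≠ M.rev a) : ∃ I, M.IsDigonSide a b I := by
  classical
  cases nonempty_fintype M.Dart
  obtain ⟨φ, hφ, hjump⟩ := hM.planar.jordan [a, b] (by
    simp only [List.map_cons, List.map_nil, h1, h2]
    exact List.Perm.swap _ _ _)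
  have hab : a ≠ b := fun h => hM.loopless a (by rw [← h1, h])
  have hne' : M.rev b ≠ a := fun h => hne (M.rev_inj h)
  have hother := (jump_eq_of_notMem hφ hjump).1
  have ja : φ a - φ (M.rev a) = 1 := by
    rw [hjump]; simp [hab.symm, hne, (M.rev_ne a).symm]
  have jb : φ b - φ (M.rev b) = 1 := by
    rw [hjump]; simp [hab, hne'.symm, (M.rev_ne b).symm]
  -- the jumps of the indicator of one label cancel at `M.src a`
  have hba : φ b = φ a := by
    let χ : M.Dart → ℚ := fun d => if φ d = φ a then 1 else 0
    have h3 := M.vertex_sum_jump χ (fun d => by simp [χ, hφ]) (M.src a)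
    rw [← Finset.sum_subset (s₁ := {a, M.rev b}), Finset.sum_pair hne'.symm, M.rev_rev] at h3
    · have h4 : φ (M.rev a) ≠ φ a := fun h => by rw [h, sub_self] at ja; norm_num at ja
      by_contra h5
      simp only [χ, h4, h5, if_true, if_false] at h3
      split_ifs at h3 <;> norm_num at h3
    · intro d hd
      rw [Finset.mem_insert, Finset.mem_singleton] at hd
      rw [Finset.mem_filter]
      refine ⟨Finset.mem_univ _, ?_⟩
      rcases hd with rfl | rfl
      · rfl
      · exact h2
    · intro d hd hd'
      rw [Finset.mem_filter] at hd
      rw [Finset.mem_insert, Finset.mem_singleton, not_or] at hd'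
      have : φ (M.rev d) = φ d := by
        refine hother d ?_ ?_
        · simp only [List.mem_cons, List.not_mem_nil, or_false, not_or]
          refine ⟨hd'.1, ?_⟩
          rintro rfl
          exact hM.loopless a (by rw [← hd.2, h1])
        · simp only [List.mem_cons, List.not_mem_nil, or_false, not_or]
          refine ⟨fun e => hM.loopless a ?_, fun e => hd'.2 (M.rev_inj e)⟩
          rw [← hd.2, M.rev_inj e, M.src_rev]
      simp [χ, this]
  refine ⟨{d | φ d = φ a}, h1, h2, fun d => ?_, rfl, hba, fun h => ?_, fun h => ?_, ?_⟩
  · simp [hφ]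
  · rw [Set.mem_ofPred_eq] at h
    rw [h, sub_self] at ja; norm_num at ja
  · rw [Set.mem_ofPred_eq] at h
    rw [h, hba, sub_self] at jb; norm_num at jb
  · intro d hd hda hdb
    rw [Set.mem_ofPred_eq] at hd ⊢
    by_cases h3 : M.rev d = a
    · rw [h3]
    by_cases h4 : M.rev d = b
    · rw [h4, hba]
    rw [hother d (by simp [hda, hdb]) (by simp [h3, h4]), hd]

/-- Some vertex of degree at most five has no two parallel edges: take it inside a digon whose inside
is minimal, or anywhere if there are no parallel edges. -/
lemma exists_low_degree : ∃ v, Nat.card {d : M.Dart // M.src d = v} < 6 ∧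
    ∀ d e, M.src d = v → M.src e = v → M.tgt d = M.tgt e → d = e := by
  classical
  by_cases hex : ∃ n, ∃ a b I, M.IsDigonSide a b I ∧ I.ncard = n
  · obtain ⟨a, b, I, hI, hn⟩ := Nat.find_spec hex
    have hmin : ∀ a' b' J, M.IsDigonSide a' b' J → ¬ J ⊂ I := fun a' b' J hJ hlt =>
      Nat.find_min hex (by rw [← hn]; exact Set.ncard_lt_ncard hlt) ⟨a', b', J, hJ, rfl⟩
    obtain ⟨v, hva, hvb, hv, hdeg⟩ := hI.exists_degree_lt_six hM
    refine ⟨v, hdeg, fun d e hd he hde => ?_⟩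
    by_contra hne
    obtain ⟨J, hJ⟩ := hM.exists_digonSide (a := d) (b := M.rev e) (by rw [M.src_rev, hde])
      (by rw [M.tgt_rev, hd, he]) (fun h => hne (M.rev.injective h).symm)
    have hdI := hI.interior_mem hva hvb hv d hd
    have heI := hI.interior_mem hva hvb hv e he
    -- the outside of the minimal digon lies on one side of the new one, whose other side is smaller
    by_cases hS : (J ∩ Iᶜ).Nonempty
    · have := hI.compl.eq_of_closed hM (S := J ∩ Iᶜ) Set.inter_subset_right hS
        (fun x hx => ⟨(hJ.face_mem x).2 hx.1, (not_congr (hI.face_mem x)).2 hx.2⟩)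
        (fun x hx hx' => ⟨hJ.rev_mem x hx.1 (fun h => hx.2 (h ▸ hdI.1))
          (fun h => hx.2 (h ▸ heI.2)), hx'⟩)
      refine hmin _ _ _ hJ.compl ⟨fun x hx => ?_, fun h => h hdI.1 hJ.left_mem⟩
      by_contra hxI
      exact hx (this.ge hxI).1
    · refine hmin _ _ _ hJ ⟨fun x hx => ?_, fun h => hJ.rev_left (h hdI.2)⟩
      by_contra hxI
      exact hS ⟨x, hx, hxI⟩
  · have : ∃ v, Nat.card {d : M.Dart // M.src d = v} < 6 := by
      by_contra hcon
      push Not at hcon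
      have h1 := M.card_mul_le Set.univ 6 fun v _ => hcon v
      have h2 := hM.card_dart
      simp only [Set.mem_univ, Set.ncard_univ] at h1
      rw [show {d : M.Dart | True} = Set.univ from rfl, Set.ncard_univ] at h1
      omega
    obtain ⟨v, hv⟩ := this
    refine ⟨v, hv, fun d e hd he hde => ?_⟩
    by_contra hne
    obtain ⟨J, hJ⟩ := hM.exists_digonSide (a := d) (b := M.rev e) (by rw [M.src_rev, hde])
      (by rw [M.tgt_rev, hd, he]) (fun h => hne (M.rev.injective h).symm)
    exact hex ⟨_, _, _, J, hJ, rfl⟩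

end IsTriangulation

/-! ### Nonadjacent neighbours, and the reduction step -/

namespace IsWheel
variable {M : RotationSystem} {k : ℕ} [NeZero k] {s : Fin k → M.Dart} (hs : M.IsWheel s)
include hs

lemma rotate (j : Fin k) : M.IsWheel fun i => s (i + j) where
  rot_spoke i := by rw [hs.rot_spoke]; congr 1; abel
  tgt_injective i i' h := add_right_cancel (hs.tgt_injective h)
  triangle i := hs.triangle _

variable (hM : M.IsTriangulation)
include hM

lemma lt_card : k < Nat.card M.Vert := by
  have h : Function.Injective (fun o : Option (Fin k) => o.elim (M.src (s 0)) fun i => M.tgt (s i)) := by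
    rintro (_ | i) (_ | j) h
    · rfl
    · exact absurd h.symm (hs.tgt_ne hM j)
    · exact absurd h (hs.tgt_ne hM i)
    · exact congrArg some (hs.tgt_injective h)
  have := Nat.card_le_card_of_injective _ h
  simp only [Nat.card_eq_fintype_card (α := Option (Fin k)), Fintype.card_option,
    Fintype.card_fin] at this
  omega

/-- Suppose two neighbours `a` and `c` of the center of a wheel are adjacent. Then the triangle formed
by them and the center separates the neighbours on the two sides: there is a label `p`, constant on
either side but changing from one to the other, that agrees for adjacent neighbours. -/
lemma exists_potential_of_adjacent {a c : Fin k} (hac : M.Adjacent (M.tgt (s a)) (M.tgt (s c))) :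
    ∃ p : Fin k → ℚ, (∀ i, p (i + 1) = p i + (if i + 1 = a then 1 else 0) - if i + 1 = c then 1 else 0) ∧
      ∀ b d, b ≠ a → b ≠ c → d ≠ a → d ≠ c → M.Adjacent (M.tgt (s b)) (M.tgt (s d)) → p b = p d := by
  classical
  obtain ⟨e, he, he'⟩ := hac
  obtain ⟨φ, hφ, hjump⟩ := hM.planar.jordan [s a, e, M.rev (s c)] (by
    simp only [List.map_cons, List.map_nil, he, he', M.tgt_rev, M.src_rev, hs.src_spoke]
    exact (List.perm_append_singleton _ [_, _]).symm)
  obtain ⟨hother, hconst⟩ := jump_eq_of_notMem hφ hjump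
  have h1 : ∀ i j, s i ≠ M.rev (s j) := fun i j h => hs.tgt_ne hM j (by
    rw [← M.src_rev, ← h, hs.src_spoke])
  have h2 : ∀ i, s i ≠ e := fun i h => hs.tgt_ne hM a (by rw [← he, ← h, hs.src_spoke])
  have h3 : ∀ i, M.rev (s i) ≠ e := fun i h => hs.tgt_ne hM c (by
    rw [← he', ← h, M.tgt_rev, hs.src_spoke])
  have hss : ∀ i j, s i = s j ↔ i = j := fun i j => hs.spoke_injective.eq_iff
  have hrr : ∀ i j, M.rev (s i) = M.rev (s j) ↔ i = j := fun i j =>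
    (M.rev.injective.comp hs.spoke_injective).eq_iff
  refine ⟨fun i => φ (s i), fun i => ?_, fun b d hba hbc hda hdc hbd => ?_⟩
  · have h4 := hjump (s (i + 1))
    rw [← hφ (M.rev (s (i + 1))), hs.face_rev_spoke] at h4
    have e1 : [s a, e, M.rev (s c)].count (s (i + 1)) = if i + 1 = a then 1 else 0 := by
      simp [List.count_cons, (h2 _).symm, hss, eq_comm (a := i + 1), (h1 _ _).symm]
    have e2 : [s a, e, M.rev (s c)].count (M.rev (s (i + 1))) = if i + 1 = c then 1 else 0 := by
      simp [List.count_cons, h1, (h3 _).symm, hrr, eq_comm (a := i + 1)]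
    rw [e1, e2] at h4
    push_cast at h4
    simp only
    linarith
  · obtain ⟨g, hg, hg'⟩ := hbd
    have hspoke : ∀ j, j ≠ a → j ≠ c → φ (M.rev (s j)) = φ (s j) := fun j ha hc =>
      hother _ (by simp [hss, h2, h1, ha]) (by simp [hrr, h3, (h1 _ _).symm, hc])
    have hv : ∀ j, j ≠ a → j ≠ c → ∀ x ∈ [s a, e, M.rev (s c)],
        M.src x ≠ M.tgt (s j) ∧ M.tgt x ≠ M.tgt (s j) := by
      intro j ha hc x hx
      have ha' : M.tgt (s a) ≠ M.tgt (s j) := hs.tgt_injective.ne ha.symm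
      have hc' : M.tgt (s c) ≠ M.tgt (s j) := hs.tgt_injective.ne hc.symm
      simp only [List.mem_cons, List.not_mem_nil, or_false] at hx
      rcases hx with rfl | rfl | rfl
      · exact ⟨by rw [hs.src_spoke]; exact (hs.tgt_ne hM j).symm, ha'⟩
      · exact ⟨by rwa [he], by rwa [he']⟩
      · exact ⟨hc', by rw [M.tgt_rev, hs.src_spoke]; exact (hs.tgt_ne hM j).symm⟩
    have e1 : φ g = φ (M.rev (s b)) := hconst _ (hv b hba hbc) _ _ hg rfl
    have e2 : φ (M.rev g) = φ (M.rev (s d)) := hconst _ (hv d hda hdc) _ _ hg' rfl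
    have e3 : φ (M.rev g) = φ g := hother _
      (fun h => (hv b hba hbc _ h).1 hg) (fun h => (hv b hba hbc _ h).2 (by rw [M.tgt_rev, hg]))
    change φ (s b) = φ (s d)
    rw [← hspoke b hba hbc, ← hspoke d hda hdc, ← e1, ← e2, e3]

end IsWheel

namespace IsTriangulation
variable {M : RotationSystem} (hM : M.IsTriangulation)
include hM

/-- The spokes at a vertex of degree `k`. Neighbours that follow each other are distinct, and if all
are distinct, there is a wheel. -/
lemma exists_isWheel {k : ℕ} [NeZero k] {v : M.Vert}
    (hk : Nat.card {d : M.Dart // M.src d = v} = k) : ∃ s : Fin k → M.Dart,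
    (∀ i, M.src (s i) = v) ∧ Function.Injective s ∧ (∀ i, M.tgt (s i) ≠ M.tgt (s (i + 1))) ∧
    (Function.Injective (fun i => M.tgt (s i)) → M.IsWheel s) := by
  obtain ⟨s, hsv, hrot, hinj⟩ := M.exists_spokes hk
  refine ⟨s, hsv, hinj, fun i => ?_, fun h => ⟨hrot, h, fun i => hM.triangular _⟩⟩
  have h := M.rot_face (M.face (M.face (s i)))
  rw [hM.triangular, hrot] at h
  rw [h, ← M.src_face, M.tgt_rev, M.src_face (M.face (s i))]
  exact hM.loopless _

/-- Some contracting operation applies to every triangulation with more than three vertices. -/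
theorem exists_contractingStep (h4 : 4 ≤ Nat.card M.Vert) :
    ∃ N : RotationSystem, ContractingStep M N ∧ Nat.card N.Vert < Nat.card M.Vert := by
  by_cases hdeg : M.MinDegreeGE 4
  · obtain ⟨v, hv, hinj⟩ := hM.exists_low_degree
    have hv4 := hdeg v
    have hwheel : ∀ k [NeZero k], Nat.card {d : M.Dart // M.src d = v} = k →
        ∃ s : Fin k → M.Dart, M.IsWheel s := fun k _ hk => by
      obtain ⟨s, hsv, hsinj, -, hw⟩ := hM.exists_isWheel hk
      exact ⟨s, hw fun i j h => hsinj (hinj _ _ (hsv i) (hsv j) h)⟩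
    obtain hk | hk : Nat.card {d : M.Dart // M.src d = v} = 4 ∨
      Nat.card {d : M.Dart // M.src d = v} = 5 := by omega
    · obtain ⟨s, hs⟩ := hwheel 4 hk
      have hlt := hs.lt_card hM
      have : ∃ s : Fin 4 → M.Dart, M.IsWheel s ∧ ¬ M.Adjacent (M.tgt (s 0)) (M.tgt (s 2)) := by
        -- the pairs `0`, `2` and `1`, `3` cannot both be adjacent
        by_cases h02 : M.Adjacent (M.tgt (s 0)) (M.tgt (s 2))
        · refine ⟨_, hs.rotate 1, fun h13 => ?_⟩
          obtain ⟨p, hp, hp'⟩ := hs.exists_potential_of_adjacent hM h02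
          have e := hp' 1 3 (by decide) (by decide) (by decide) (by decide) h13
          have e1 := hp 1
          have e2 := hp 2
          simp at e1 e2
          change p 3 = p 2 at e2
          change p 2 = p 1 - 1 at e1
          linarith
        · exact ⟨s, hs, h02⟩
      obtain ⟨s, hs, hn⟩ := this
      obtain ⟨N, hN, hc, hlt⟩ := hM.exists_contract4 hs hn (by omega)
      exact ⟨N, ⟨hM, hN, Or.inr (Or.inr ⟨hdeg, Or.inl hc⟩)⟩, hlt⟩
    · obtain ⟨s, hs⟩ := hwheel 5 hk
      have hlt := hs.lt_card hM
      have : ∃ s : Fin 5 → M.Dart, M.IsWheel s ∧ ¬ M.Adjacent (M.tgt (s 1)) (M.tgt (s 4)) := by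
        -- the pairs `1`, `4` and `2`, `0` cannot both be adjacent
        by_cases h14 : M.Adjacent (M.tgt (s 1)) (M.tgt (s 4))
        · refine ⟨_, hs.rotate 1, fun h20 => ?_⟩
          obtain ⟨p, hp, hp'⟩ := hs.exists_potential_of_adjacent hM h14
          have e := hp' 2 0 (by decide) (by decide) (by decide) (by decide) h20
          have e1 := hp 2
          have e2 := hp 3
          have e3 := hp 4
          simp at e1 e2 e3
          change p 3 = p 2 at e1
          change p 4 = p 3 - 1 at e2
          change p 0 = p 4 at e3
          linarith
        · exact ⟨s, hs, h14⟩
      obtain ⟨s, hs, hn⟩ := this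
      obtain ⟨N, hN, hc, hlt⟩ := hM.exists_contract5 hs hn (by omega)
      exact ⟨N, ⟨hM, hN, Or.inr (Or.inr ⟨hdeg, Or.inr hc⟩)⟩, hlt⟩
  · obtain ⟨v, hv⟩ := not_forall.1 hdeg
    push Not at hv
    obtain ⟨d₀, hd₀⟩ := hM.exists_dart v
    have hpos : 0 < Nat.card {d : M.Dart // M.src d = v} :=
      Nat.card_pos_iff.2 ⟨⟨⟨d₀, hd₀⟩⟩, inferInstance⟩
    obtain hk | hk | hk : Nat.card {d : M.Dart // M.src d = v} = 1 ∨
      Nat.card {d : M.Dart // M.src d = v} = 2 ∨ Nat.card {d : M.Dart // M.src d = v} = 3 := by omega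
    · -- the only neighbour would have to differ from the next one, which is itself
      obtain ⟨s, -, -, h, -⟩ := hM.exists_isWheel hk
      exact absurd rfl (h 0)
    · obtain ⟨s, -, -, h, hw⟩ := hM.exists_isWheel hk
      have hs := hw fun i j hij => by
        by_contra hne
        have : i + 1 = j := by clear hij; revert i j; decide
        exact h i (this ▸ hij)
      by_cases hrim : M.rim s 1 = M.rev (M.rim s 0)
      · -- the two triangles at the center are the whole surface
        have hu := hM.eq_univ_of_closed (M.hub s) ⟨s 0, 0, Or.inl rfl⟩
          (fun d hd => hs.face_mem_hub hd) (by
            rintro d ⟨i, rfl | rfl | rfl⟩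
            · exact ⟨i, Or.inr (Or.inr rfl)⟩
            · refine ⟨i + 1, Or.inr (Or.inl ?_)⟩
              fin_cases i
              · exact hrim.symm
              · exact (M.rev_inj hrim.symm).symm
            · exact ⟨i, Or.inl (M.rev_rev _)⟩)
        have h1 := hs.card_hub hM
        have h2 := hM.card_dart
        rw [hu, Nat.card_univ] at h1
        omega
      · obtain ⟨N, hN, hc, hlt⟩ := hM.exists_contract2 hs hrim h4
        exact ⟨N, ⟨hM, hN, Or.inl hc⟩, hlt⟩
    · obtain ⟨s, -, -, h, hw⟩ := hM.exists_isWheel hk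
      have hs := hw fun i j hij => by
        by_contra hne
        have : i + 1 = j ∨ j + 1 = i := by clear hij; revert i j; decide
        rcases this with this | this
        · exact h i (this ▸ hij)
        · exact h j (this ▸ hij.symm)
      obtain ⟨N, hN, hc, hlt⟩ := hM.exists_contract3 hs h4
      exact ⟨N, ⟨hM, hN, Or.inr (Or.inl hc)⟩, hlt⟩

end IsTriangulation

/-! ### Reduction to `K₃` and its reversal -/

namespace IsTriangulation
variable {M : RotationSystem} (hM : M.IsTriangulation)
include hM

lemma tgt_face_ne (d : M.Dart) : M.tgt (M.face d) ≠ M.src d ∧ M.tgt (M.face d) ≠ M.tgt d := by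
  constructor
  · have := hM.loopless (M.face (M.face d))
    rw [← M.src_face (M.face (M.face d)), hM.triangular, M.src_face] at this
    exact this
  · rw [← M.src_face d]
    exact (hM.loopless _).symm

lemma isDrawingOf_top (h3 : Nat.card M.Vert = 3) : M.IsDrawingOf (⊤ : SimpleGraph (Fin 3)) := by
  classical
  obtain ⟨d₀⟩ := hM.nonempty_dart
  let g : Fin 3 → M.Dart := ![d₀, M.face d₀, M.face (M.face d₀)]
  have hg : ∀ i, M.tgt (g i) = M.src (g (i + 1)) := by
    intro i
    rw [← M.src_face]
    fin_cases i
    · rfl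
    · rfl
    · exact congrArg M.src (hM.triangular d₀)
  have hinj : Function.Injective (M.src ∘ g) := by
    intro i j h
    by_contra hne
    have : i + 1 = j ∨ j + 1 = i := by clear h; revert i j; decide
    rcases this with rfl | rfl
    · exact hM.loopless (g i) (h.trans (hg i).symm)
    · exact hM.loopless (g j) (h.symm.trans (hg j).symm)
  have hbij : Function.Bijective (M.src ∘ g) := by
    rw [Nat.bijective_iff_injective_and_card]
    exact ⟨hinj, by simp [h3]⟩
  let e : Fin 3 ≃ M.Vert := Equiv.ofBijective _ hbij
  have he : ∀ i, M.src (g i) = e i := fun i => rfl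
  -- there are six darts and six ordered pairs of vertices, each pair occurring in the face of `d₀`
  let T : M.Dart → {p : Fin 3 × Fin 3 // p.1 ≠ p.2} := fun d =>
    ⟨(e.symm (M.src d), e.symm (M.tgt d)), fun h => hM.loopless d (e.symm.injective h)⟩
  have hT : Function.Bijective T := by
    rw [Nat.bijective_iff_surjective_and_card]
    constructor
    · rintro ⟨⟨i, j⟩, hij⟩
      have : i + 1 = j ∨ j + 1 = i := by revert i j; decide
      rcases this with rfl | rfl
      · refine ⟨g i, Subtype.ext (Prod.ext ?_ ?_)⟩
        · simp [T, he]
        · simp [T, hg, he]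
      · refine ⟨M.rev (g j), Subtype.ext (Prod.ext ?_ ?_)⟩
        · simp [T, M.src_rev, hg, he]
        · simp [T, M.tgt_rev, he]
    · have h1 := hM.card_dart
      have h2 : Nat.card {p : Fin 3 × Fin 3 // p.1 ≠ p.2} = 6 := by
        rw [Nat.card_eq_fintype_card]; decide
      omega
  refine ⟨e, fun u v => ⟨fun huv => ?_, ?_⟩⟩
  · obtain ⟨d, hd⟩ := hT.2 ⟨(u, v), huv⟩
    have hd := congrArg Subtype.val hd
    refine ⟨d, ⟨?_, ?_⟩, fun d' hd' => hT.1 ?_⟩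
    · exact e.symm_apply_eq.1 (congrArg Prod.fst hd)
    · exact e.symm_apply_eq.1 (congrArg Prod.snd hd)
    · refine Subtype.ext (Eq.trans ?_ hd.symm)
      simp [T, hd'.1, hd'.2]
  · rintro ⟨d, hd1, hd2⟩
    rw [SimpleGraph.top_adj]
    rintro rfl
    exact hM.loopless d (hd1.trans hd2.symm)

theorem reducesToK3 : M.ReducesToK3 := by
  induction h : Nat.card M.Vert using Nat.strong_induction_on generalizing M with
  | _ n ih =>
    rcases hM.three_le.eq_or_lt with h3 | h4
    · exact ⟨M, ReflTransGen.refl, hM.isDrawingOf_top h3.symm⟩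
    · obtain ⟨N, hstep, hlt⟩ := hM.exists_contractingStep h4
      obtain ⟨T, hT, hK⟩ := ih _ (h ▸ hlt) hstep.2.1 rfl
      exact ⟨T, ReflTransGen.head hstep hT, hK⟩

/-- Any two triangulations that draw `K₃` are isomorphic, since a dart is determined by its ends and
the faces by the third vertex. -/
lemma nonempty_iso_of_top {N : RotationSystem} (hN : N.IsTriangulation)
    (h1 : M.IsDrawingOf (⊤ : SimpleGraph (Fin 3))) (h2 : N.IsDrawingOf (⊤ : SimpleGraph (Fin 3))) :
    Nonempty (Iso M N) := by
  obtain ⟨e₁, he₁⟩ := h1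
  obtain ⟨e₂, he₂⟩ := h2
  have key : ∀ {M : RotationSystem} (e : Fin 3 ≃ M.Vert), (∀ u v,
      ((⊤ : SimpleGraph (Fin 3)).Adj u v → ∃! d, M.src d = e u ∧ M.tgt d = e v) ∧
        (M.Adjacent (e u) (e v) → (⊤ : SimpleGraph (Fin 3)).Adj u v)) →
      ∀ u v, u ≠ v → ∃! d, M.src d = u ∧ M.tgt d = v := by
    intro M e he u v huv
    have := (he (e.symm u) (e.symm v)).1 (by simpa using huv)
    simpa using this
  have k1 := key e₁ he₁
  have k2 := key e₂ he₂
  let E : M.Vert ≃ N.Vert := e₁.symm.trans e₂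
  choose F hF using fun d => (k2 (E (M.src d)) (E (M.tgt d)) (E.injective.ne (hM.loopless d))).exists
  choose G hG using fun d => (k1 (E.symm (N.src d)) (E.symm (N.tgt d))
    (E.symm.injective.ne (hN.loopless d))).exists
  have u1 : ∀ d d', M.src d = M.src d' → M.tgt d = M.tgt d' → d = d' := fun d d' h h' =>
    (k1 _ _ (hM.loopless d)).unique ⟨rfl, rfl⟩ ⟨h.symm, h'.symm⟩
  have u2 : ∀ d d', N.src d = N.src d' → N.tgt d = N.tgt d' → d = d' := fun d d' h h' =>
    (k2 _ _ (hN.loopless d)).unique ⟨rfl, rfl⟩ ⟨h.symm, h'.symm⟩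
  have third : ∀ a b c c' : N.Vert, a ≠ b → c ≠ a → c ≠ b → c' ≠ a → c' ≠ b → c = c' := by
    have h : ∀ a b c c' : Fin 3, a ≠ b → c ≠ a → c ≠ b → c' ≠ a → c' ≠ b → c = c' := by decide
    intro a b c c' h1 h2 h3 h4 h5
    exact e₂.symm.injective (h (e₂.symm a) (e₂.symm b) _ _ (e₂.symm.injective.ne h1)
      (e₂.symm.injective.ne h2) (e₂.symm.injective.ne h3) (e₂.symm.injective.ne h4)
      (e₂.symm.injective.ne h5))
  have hrev : ∀ d, N.rev (F d) = F (M.rev d) := fun d => u2 _ _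
    (by rw [N.src_rev, (hF d).2, (hF (M.rev d)).1, M.src_rev])
    (by rw [N.tgt_rev, (hF d).1, (hF (M.rev d)).2, M.tgt_rev])
  have hface : ∀ d, N.face (F d) = F (M.face d) := fun d => u2 _ _
    (by rw [N.src_face, (hF d).2, (hF _).1, M.src_face]) (by
      refine third (N.src (F d)) (N.tgt (F d)) _ _ (hN.loopless _) (hN.tgt_face_ne _).1
        (hN.tgt_face_ne _).2 ?_ ?_
      · rw [(hF _).2, (hF d).1]; exact E.injective.ne (hM.tgt_face_ne d).1
      · rw [(hF _).2, (hF d).2]; exact E.injective.ne (hM.tgt_face_ne d).2)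
  have hrot : ∀ {M : RotationSystem}, M.IsTriangulation → ∀ d, M.rot d = M.rev (M.face (M.face d)) :=
    fun {M} hM d => by rw [← M.rot_face, hM.triangular]
  exact ⟨{
    vert := E
    dart := ⟨F, G, fun d => u1 _ _ (by simp [(hG _).1, (hF _).1]) (by simp [(hG _).2, (hF _).2]),
      fun d => u2 _ _ (by simp [(hG _).1, (hF _).1]) (by simp [(hG _).2, (hF _).2])⟩
    src_dart := fun d => (hF d).1
    rev_dart := hrev
    rot_dart := fun d => by
      change N.rot (F d) = F (M.rot d)
      rw [hrot hN, hrot hM, hface, hface, hrev] }⟩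

end IsTriangulation

lemma Iso.face_dart {M N : RotationSystem} (φ : Iso M N) (d : M.Dart) :
    N.face (φ.dart d) = φ.dart (M.face d) := by
  apply N.rot.injective
  rw [N.rot_face, φ.rot_dart, M.rot_face, φ.rev_dart]

lemma IsDeletionQuotient.map_iso {M N N' : RotationSystem} (φ : Iso N N') {c : M.Vert}
    {idV : M.Vert → M.Vert → Prop} {idE : M.Dart → M.Dart → Prop} {f : M.Vert → N.Vert}
    {q : M.Dart → N.Dart} (h : IsDeletionQuotient M N c idV idE f q) :
    IsDeletionQuotient M N' c idV idE (φ.vert ∘ f) (φ.dart ∘ q) where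
  vert_surj w := by
    obtain ⟨u, hu, hw⟩ := h.vert_surj (φ.vert.symm w)
    exact ⟨u, hu, by simp [hw]⟩
  vert_eq u v hu hv := by
    rw [← h.vert_eq u v hu hv]
    exact φ.vert.apply_eq_iff_eq
  dart_surj e := by
    obtain ⟨d, hd, he⟩ := h.dart_surj (φ.dart.symm e)
    exact ⟨d, hd, by simp [he]⟩
  dart_eq d e hd he := by
    rw [← h.dart_eq d e hd he]
    exact φ.dart.apply_eq_iff_eq
  src_map d hd := by
    rw [Function.comp_apply, φ.src_dart, h.src_map d hd]; rfl
  rev_map d hd := by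
    rw [Function.comp_apply, φ.rev_dart, h.rev_map d hd]; rfl

lemma KeepsFaces.map_iso {M N N' : RotationSystem} (φ : Iso N N') {k : ℕ} [NeZero k]
    {s : Fin k → M.Dart} {q : M.Dart → N.Dart} (h : KeepsFaces M N s q) :
    KeepsFaces M N' s (φ.dart ∘ q) := fun d hd hd' => by
  rw [Function.comp_apply, φ.face_dart, h d hd hd']; rfl

/-- The graph to which an extending operation is applied may be replaced by an isomorphic one, without
changing the result. -/
lemma ExtendingStep.map_iso {M N N' : RotationSystem} (φ : Iso M N') (hN' : N'.IsTriangulation)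
    (h : ExtendingStep M N) : ExtendingStep N' N := by
  obtain ⟨-, hN, h⟩ := h
  refine ⟨hN', hN, ?_⟩
  rcases h with ⟨s, hs, hr, f, q, hq, hk⟩ | ⟨s, hs, f, q, hq, hk, hf⟩ | ⟨s, hs, hn, f, q, hq, hk⟩ |
    ⟨s, hs, hn, f, q, hq, hk, h1, h2, h3⟩
  · exact Or.inl ⟨s, hs, hr, _, _, hq.map_iso φ, hk.map_iso φ⟩
  · exact Or.inr (Or.inl ⟨s, hs, _, _, hq.map_iso φ, hk.map_iso φ, fun i => by
      simp only [Function.comp_apply, φ.face_dart, hf]⟩)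
  · exact Or.inr (Or.inr (Or.inl ⟨s, hs, hn, _, _, hq.map_iso φ, hk.map_iso φ⟩))
  · exact Or.inr (Or.inr (Or.inr ⟨s, hs, hn, _, _, hq.map_iso φ, hk.map_iso φ, by
      simp only [Function.comp_apply, φ.face_dart, h1], by
      simp only [Function.comp_apply, φ.face_dart, h2], by
      simp only [Function.comp_apply, φ.face_dart, h3]⟩))

lemma ContractingStep.extendingStep {M N : RotationSystem} (h : ContractingStep M N) :
    ExtendingStep N M :=
  ⟨h.2.1, h.1, h.2.2.imp_right (Or.imp_right And.right)⟩

lemma isTriangulation_of_reflTransGen {M N : RotationSystem} (hM : M.IsTriangulation)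
    (h : ReflTransGen ContractingStep M N) : N.IsTriangulation := by
  induction h with
  | refl => exact hM
  | tail _ h _ => exact h.2.1

/-- Both triangulations reduce to copies of `K₃`, and the second reduction is reversed from the copy
reached by the first; only the first reversed operation has to be transported. -/
theorem IsTriangulation.transformsInto {M N : RotationSystem} (hM : M.IsTriangulation)
    (hN : N.IsTriangulation) : M.TransformsInto N := by
  obtain ⟨T, hMT, hT⟩ := hM.reducesToK3
  obtain ⟨T', hNT', hT'⟩ := hN.reducesToK3
  have tT := isTriangulation_of_reflTransGen hM hMT
  have tT' := isTriangulation_of_reflTransGen hN hNT'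
  have hMT' : ReflTransGen OperationStep M T :=
    ReflTransGen.mono (fun _ _ h => Or.inl h) _ _ hMT
  rcases hNT'.cases_tail with rfl | ⟨B, hNB, hB⟩
  · exact ⟨T, hMT', tT.nonempty_iso_of_top tT' hT hT'⟩
  · obtain ⟨φ⟩ := tT'.nonempty_iso_of_top tT hT' hT
    have h1 : ExtendingStep T B := hB.extendingStep.map_iso φ tT
    have h2 : ReflTransGen OperationStep B N :=
      ReflTransGen.mono (r := Function.swap ContractingStep)
        (fun _ _ h => Or.inr (ContractingStep.extendingStep h)) _ _ hNB.swap
    exact ⟨N, (hMT'.tail (Or.inr h1)).trans h2, ⟨⟨Equiv.refl _, Equiv.refl _, fun _ => rfl,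
      fun _ => rfl, fun _ => rfl⟩⟩⟩

/-! ### Adding an edge -/

/-- A place where a dart leaving `v` can be inserted: before a dart `a` leaving `v`, given as `inl a`,
or, at an isolated vertex, before the new dart itself, given as `inr i`. -/
def IsCorner (M : RotationSystem) (v : M.Vert) (i : Bool) (A : M.Dart ⊕ Bool) : Prop :=
  (∃ a, A = Sum.inl a ∧ M.src a = v) ∨ (A = Sum.inr i ∧ ∀ d, M.src d ≠ v)

lemma exists_isCorner (M : RotationSystem) (v : M.Vert) (i : Bool) : ∃ A, M.IsCorner v i A := by
  by_cases h : ∃ a, M.src a = v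
  · obtain ⟨a, ha⟩ := h
    exact ⟨Sum.inl a, Or.inl ⟨a, rfl, ha⟩⟩
  · exact ⟨Sum.inr i, Or.inr ⟨rfl, not_exists.1 h⟩⟩

section AddEdge
variable (M : RotationSystem) {u w : M.Vert} {A B : M.Dart ⊕ Bool}

/-- The starts of the darts after adding an edge: `inr false` leads from `u` to `w`, and `inr true` is
its reverse. -/
def addEdgeSrc (u w : M.Vert) : M.Dart ⊕ Bool → M.Vert :=
  Sum.elim M.src fun i => if i then w else u

open Classical in
/-- The rotation after inserting the dart `inr false` before `A` and `inr true` before `B`. -/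
noncomputable def addEdgeRot (A B : M.Dart ⊕ Bool) : Equiv.Perm (M.Dart ⊕ Bool) :=
  Equiv.swap (Sum.inr false) A * Equiv.swap (Sum.inr true) B * Equiv.sumCongr M.rot 1

variable {M} (huw : u ≠ w) (hA : M.IsCorner u false A) (hB : M.IsCorner w true B)

lemma IsCorner.ne {i j : Bool} {v : M.Vert} {A : M.Dart ⊕ Bool} (hA : M.IsCorner v i A)
    (h : i ≠ j) : A ≠ Sum.inr j := by
  rintro rfl
  rcases hA with ⟨a, h', -⟩ | ⟨h', -⟩
  · cases h'
  · exact h (Sum.inr.inj h').symm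

include huw hA hB in
lemma corner_ne : A ≠ B := by
  rintro rfl
  rcases hA with ⟨a, rfl, ha⟩ | ⟨rfl, -⟩
  · rcases hB with ⟨b, h, hb⟩ | ⟨h, -⟩
    · cases h
      exact huw (ha.symm.trans hb)
    · cases h
  · exact hB.ne (by decide) rfl

open Classical in
lemma addEdgeRot_false (hB : M.IsCorner w true B) : M.addEdgeRot A B (Sum.inr false) = A := by
  have h2 := hB.ne (j := false) (by decide)
  simp [addEdgeRot, Equiv.swap_apply_of_ne_of_ne (a := Sum.inr true) (b := B)
    (x := Sum.inr false) (by simp) h2.symm]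

open Classical in
lemma addEdgeRot_true (hB : M.IsCorner w true B) (hAB : A ≠ B) :
    M.addEdgeRot A B (Sum.inr true) = B := by
  have h2 := hB.ne (j := false) (by decide)
  simp [addEdgeRot, Equiv.swap_apply_of_ne_of_ne h2 hAB.symm]

open Classical in
lemma addEdgeRot_left {d : M.Dart} (h : A = Sum.inl (M.rot d)) (hAB : A ≠ B) :
    M.addEdgeRot A B (Sum.inl d) = Sum.inr false := by
  subst h
  simp [addEdgeRot, Equiv.swap_apply_of_ne_of_ne (a := Sum.inr true) (b := B)
    (x := Sum.inl (M.rot d)) (by simp) hAB]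

open Classical in
lemma addEdgeRot_right {d : M.Dart} (h : B = Sum.inl (M.rot d)) (hA : M.IsCorner u false A) :
    M.addEdgeRot A B (Sum.inl d) = Sum.inr true := by
  subst h
  have h1 := hA.ne (j := true) (by decide)
  simp [addEdgeRot, Equiv.swap_apply_of_ne_of_ne (a := Sum.inr false) (b := A)
    (x := Sum.inr true) (by simp) h1.symm]

open Classical in
lemma addEdgeRot_of_ne {d : M.Dart} (h1 : A ≠ Sum.inl (M.rot d)) (h2 : B ≠ Sum.inl (M.rot d)) :
    M.addEdgeRot A B (Sum.inl d) = Sum.inl (M.rot d) := by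
  simp [addEdgeRot, Equiv.swap_apply_of_ne_of_ne (a := Sum.inr true) (b := B)
    (x := Sum.inl (M.rot d)) (by simp) h2.symm, Equiv.swap_apply_of_ne_of_ne (a := Sum.inr false)
    (b := A) (x := Sum.inl (M.rot d)) (by simp) h1.symm]

include huw hA hB in
lemma addEdgeRot_sameCycle (d : M.Dart) :
    (M.addEdgeRot A B).SameCycle (Sum.inl d) (Sum.inl (M.rot d)) := by
  by_cases h1 : A = Sum.inl (M.rot d)
  · refine ⟨2, ?_⟩
    change (M.addEdgeRot A B) ((M.addEdgeRot A B) _) = _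
    rw [addEdgeRot_left h1 (corner_ne huw hA hB), addEdgeRot_false hB, h1]
  · by_cases h2 : B = Sum.inl (M.rot d)
    · refine ⟨2, ?_⟩
      change (M.addEdgeRot A B) ((M.addEdgeRot A B) _) = _
      rw [addEdgeRot_right h2 hA, addEdgeRot_true hB (corner_ne huw hA hB), h2]
    · refine ⟨1, ?_⟩
      rw [zpow_one, addEdgeRot_of_ne h1 h2]

lemma sameCycle_of_step {D D' : Type} [Finite D] {σ : Equiv.Perm D} {τ : Equiv.Perm D'} {f : D → D'}
    (h : ∀ d, τ.SameCycle (f d) (f (σ d))) {a b : D} (hab : σ.SameCycle a b) :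
    τ.SameCycle (f a) (f b) := by
  obtain ⟨n, -, rfl⟩ := hab.exists_pow_eq'
  clear hab
  induction n with
  | zero => exact Equiv.Perm.SameCycle.refl _ _
  | succ n ih =>
    rw [pow_succ', Equiv.Perm.mul_apply]
    exact ih.trans (h _)

include huw hA hB in
lemma addEdge_orbits (x y : M.Dart ⊕ Bool) :
    M.addEdgeSrc u w x = M.addEdgeSrc u w y ↔ (M.addEdgeRot A B).SameCycle x y := by
  have hl : ∀ d e, M.src d = M.src e → (M.addEdgeRot A B).SameCycle (Sum.inl d) (Sum.inl e) :=
    fun d e h => sameCycle_of_step (addEdgeRot_sameCycle huw hA hB) ((M.rot_orbits d e).1 h)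
  have hp : ∀ d, M.src d = u → (M.addEdgeRot A B).SameCycle (Sum.inl d) (Sum.inr false) := by
    intro d hd
    have h1 := addEdgeRot_false (A := A) hB
    rcases hA with ⟨a, rfl, ha⟩ | ⟨-, h⟩
    · refine (hl d a (hd.trans ha.symm)).trans (Equiv.Perm.SameCycle.symm ⟨1, ?_⟩)
      rw [zpow_one, h1]
    · exact absurd hd (h d)
  have hq : ∀ d, M.src d = w → (M.addEdgeRot A B).SameCycle (Sum.inl d) (Sum.inr true) := by
    intro d hd
    have h1 := addEdgeRot_true hB (corner_ne huw hA hB)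
    rcases hB with ⟨a, rfl, ha⟩ | ⟨-, h⟩
    · refine (hl d a (hd.trans ha.symm)).trans (Equiv.Perm.SameCycle.symm ⟨1, ?_⟩)
      rw [zpow_one, h1]
    · exact absurd hd (h d)
  constructor
  · intro h
    rcases x with d | (_ | _) <;> rcases y with e | (_ | _) <;> simp [addEdgeSrc] at h
    · exact hl d e h
    · exact hp d h
    · exact hq d h
    · exact (hp e h.symm).symm
    · exact Equiv.Perm.SameCycle.refl _ _
    · exact absurd h huw
    · exact (hq e h.symm).symm
    · exact absurd h.symm huw
    · exact Equiv.Perm.SameCycle.refl _ _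
  · refine invariant_of_sameCycle fun z => ?_
    rcases z with d | (_ | _)
    · by_cases h1 : A = Sum.inl (M.rot d)
      · rw [addEdgeRot_left h1 (corner_ne huw hA hB)]
        rcases hA with ⟨a, rfl, ha⟩ | ⟨rfl, -⟩
        · simp only [Sum.inl.injEq] at h1
          simp [addEdgeSrc, ← ha, h1, M.src_rot]
        · cases h1
      · by_cases h2 : B = Sum.inl (M.rot d)
        · rw [addEdgeRot_right h2 hA]
          rcases hB with ⟨a, rfl, ha⟩ | ⟨rfl, -⟩
          · simp only [Sum.inl.injEq] at h2
            simp [addEdgeSrc, ← ha, h2, M.src_rot]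
          · cases h2
        · rw [addEdgeRot_of_ne h1 h2]
          simp [addEdgeSrc, M.src_rot]
    · rw [addEdgeRot_false hB]
      rcases hA with ⟨a, rfl, ha⟩ | ⟨rfl, -⟩
      · simp [addEdgeSrc, ha]
      · rfl
    · rw [addEdgeRot_true hB (corner_ne huw hA hB)]
      rcases hB with ⟨a, rfl, ha⟩ | ⟨rfl, -⟩
      · simp [addEdgeSrc, ha]
      · rfl

/-- The embedded graph with an additional edge between the vertices `u` and `w`, drawn at the corners
`A` and `B`. -/
noncomputable def addEdge (huw : u ≠ w) (hA : M.IsCorner u false A) (hB : M.IsCorner w true B) :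
    RotationSystem where
  Vert := M.Vert
  Dart := M.Dart ⊕ Bool
  src := M.addEdgeSrc u w
  rev := Equiv.sumCongr M.rev Equiv.boolNot
  rot := M.addEdgeRot A B
  rev_rev := by rintro (d | i) <;> simp [M.rev_rev]
  rev_ne := by rintro (d | i) <;> simp [M.rev_ne]
  rot_orbits := addEdge_orbits huw hA hB

lemma addEdge_face {x y : M.Dart ⊕ Bool}
    (h : M.addEdgeRot A B y = Equiv.sumCongr M.rev Equiv.boolNot x) :
    (addEdge huw hA hB).face x = y :=
  (addEdge huw hA hB).rot.injective (((addEdge huw hA hB).rot_face x).trans h.symm)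

lemma addEdge_face_inl {d : M.Dart} (h1 : A ≠ Sum.inl (M.rev d)) (h2 : B ≠ Sum.inl (M.rev d)) :
    (addEdge huw hA hB).face (Sum.inl d) = Sum.inl (M.face d) :=
  addEdge_face huw hA hB (by
    rw [addEdgeRot_of_ne (by rwa [M.rot_face]) (by rwa [M.rot_face]), M.rot_face]; rfl)

lemma addEdge_face_left {d : M.Dart} (h : A = Sum.inl (M.rev d)) :
    (addEdge huw hA hB).face (Sum.inl d) = Sum.inr false ∧
    (addEdge huw hA hB).face (Sum.inr true) = Sum.inl (M.face d) :=
  ⟨addEdge_face huw hA hB (by rw [addEdgeRot_false hB, h]; rfl),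
    addEdge_face huw hA hB (by
      rw [addEdgeRot_left (by rw [h, M.rot_face]) (corner_ne huw hA hB)]; rfl)⟩

lemma addEdge_face_right {d : M.Dart} (h : B = Sum.inl (M.rev d)) :
    (addEdge huw hA hB).face (Sum.inl d) = Sum.inr true ∧
    (addEdge huw hA hB).face (Sum.inr false) = Sum.inl (M.face d) :=
  ⟨addEdge_face huw hA hB (by rw [addEdgeRot_true hB (corner_ne huw hA hB), h]; rfl),
    addEdge_face huw hA hB (by rw [addEdgeRot_right (by rw [h, M.rot_face]) hA]; rfl)⟩

/-- Joining two components by an edge preserves planarity. An antisymmetric function that adds up to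
zero along the new faces does so along the old ones: the only doubtful face at `u` follows by adding
all faces of the component of `u`. The potential is then shifted on this component. -/
lemma addEdge_planar_of_not_reachable (hM : M.Planar) (h : ¬ ReflTransGen M.Adjacent u w) :
    (addEdge huw hA hB).Planar := by
  classical
  cases nonempty_fintype M.Dart
  refine planar_of_potential _ fun y g hy hg => ?_
  have hypq : y (Sum.inr true) = -y (Sum.inr false) := hy (Sum.inr false)
  -- the sum of `y` along the old face at `u`
  let Δ := g (Sum.inr false) + y (Sum.inr false) - g (Sum.inr true)
  have h1 : ∀ d, A ≠ Sum.inl (M.rev d) → B ≠ Sum.inl (M.rev d) →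
      g (Sum.inl (M.face d)) - g (Sum.inl d) = y (Sum.inl d) := by
    intro d hd hd'
    have := hg (Sum.inl d)
    rwa [addEdge_face_inl huw hA hB hd hd'] at this
  have h2 : ∀ d, A = Sum.inl (M.rev d) →
      g (Sum.inl (M.face d)) - g (Sum.inl d) = y (Sum.inl d) - Δ := by
    intro d hd
    have e1 := hg (Sum.inl d)
    have e2 := hg (Sum.inr true)
    rw [(addEdge_face_left huw hA hB hd).1] at e1
    rw [(addEdge_face_left huw hA hB hd).2] at e2
    simp only [Δ]
    linarith
  have h3 : ∀ d, B = Sum.inl (M.rev d) →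
      g (Sum.inl (M.face d)) - g (Sum.inl d) = y (Sum.inl d) + Δ := by
    intro d hd
    have e1 := hg (Sum.inl d)
    have e2 := hg (Sum.inr false)
    rw [(addEdge_face_right huw hA hB hd).1] at e1
    rw [(addEdge_face_right huw hA hB hd).2] at e2
    simp only [Δ]
    linarith
  have hΔ : Δ = 0 := by
    have hA' := hA
    rcases hA' with ⟨a, ha, hau⟩ | ⟨ha, -⟩
    · let C : Finset M.Dart := {d | ReflTransGen M.Adjacent u (M.src d)}
      have hC : ∀ d, d ∈ C ↔ ReflTransGen M.Adjacent u (M.src d) := fun d => by simp [C]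
      have hrev : ∀ d, d ∈ C → M.rev d ∈ C := fun d hd =>
        (hC _).2 (((hC d).1 hd).tail ⟨d, rfl, rfl⟩)
      have hrev' : ∀ d, M.rev d ∈ C ↔ d ∈ C := fun d =>
        ⟨fun h => by simpa [M.rev_rev] using hrev _ h, hrev d⟩
      have hface : ∀ d, M.face d ∈ C ↔ d ∈ C := fun d => by
        rw [← hrev' d, hC, hC, M.src_face, M.src_rev]
      have s1 : ∑ d ∈ C, g (Sum.inl (M.face d)) = ∑ d ∈ C, g (Sum.inl d) :=
        Finset.sum_equiv M.face (fun d => (hface d).symm) fun _ _ => rfl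
      have s2 : ∑ d ∈ C, y (Sum.inl (M.rev d)) = ∑ d ∈ C, y (Sum.inl d) :=
        Finset.sum_equiv M.rev (fun d => (hrev' d).symm) fun _ _ => rfl
      have s3 : ∑ d ∈ C, y (Sum.inl (M.rev d)) = -∑ d ∈ C, y (Sum.inl d) := by
        rw [← Finset.sum_neg_distrib]
        exact Finset.sum_congr rfl fun d _ => hy (Sum.inl d)
      have haC : M.rev a ∈ C := hrev _ ((hC a).2 (hau ▸ ReflTransGen.refl))
      have s4 : ∑ d ∈ C, (y (Sum.inl d) - (g (Sum.inl (M.face d)) - g (Sum.inl d))) = Δ := by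
        rw [Finset.sum_eq_single_of_mem _ haC]
        · rw [h2 _ (by rw [ha, M.rev_rev])]; ring
        · intro d hd hda
          rw [h1 d, sub_self]
          · rw [ha, Ne, Sum.inl.injEq]
            exact fun e => hda (M.rev_inj e.symm)
          · intro e
            rcases hB with ⟨b, hb, hbw⟩ | ⟨hb, -⟩
            · rw [hb, Sum.inl.injEq] at e
              refine h (hbw ▸ ?_)
              rw [e]
              exact (hC _).1 (hrev d hd)
            · rw [hb] at e; cases e
      rw [Finset.sum_sub_distrib, Finset.sum_sub_distrib] at s4
      linarith
    · have e := hg (Sum.inr true)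
      rw [addEdge_face huw hA hB (x := Sum.inr true) (y := Sum.inr false)
        (by rw [addEdgeRot_false hB, ha]; rfl)] at e
      simp only [Δ]
      linarith
  obtain ⟨p, hp⟩ := hM.exists_vertex_potential (fun d => y (Sum.inl d)) (fun d => g (Sum.inl d))
    (fun d => hy (Sum.inl d)) (fun d => by
      by_cases hd : A = Sum.inl (M.rev d)
      · rw [h2 d hd, hΔ, sub_zero]
      · by_cases hd' : B = Sum.inl (M.rev d)
        · rw [h3 d hd', hΔ, add_zero]
        · exact h1 d hd hd')
  let δ : ℚ := p w - p u - y (Sum.inr false)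
  obtain ⟨P, hP, hP'⟩ : ∃ P : M.Vert → ℚ, (∀ v, ReflTransGen M.Adjacent u v → P v = p v + δ) ∧
      ∀ v, ¬ ReflTransGen M.Adjacent u v → P v = p v :=
    ⟨fun v => if ReflTransGen M.Adjacent u v then p v + δ else p v, fun v hv => if_pos hv,
      fun v hv => if_neg hv⟩
  have hpq : y (Sum.inr false) = P w - P u := by
    rw [hP _ ReflTransGen.refl, hP' _ h]
    simp only [δ]
    ring
  refine ⟨P, ?_⟩
  rintro (d | (_ | _))
  · refine (hp d).trans ?_
    change _ = P (M.tgt d) - P (M.src d)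
    by_cases hd : ReflTransGen M.Adjacent u (M.src d)
    · rw [hP _ hd, hP _ (hd.tail ⟨d, rfl, rfl⟩)]
      ring
    · rw [hP' _ hd, hP' (M.tgt d) fun h' => hd (h'.tail ⟨M.rev d, rfl, M.tgt_rev d⟩)]
  · exact hpq
  · rw [hypq, hpq]
    change _ = P u - P w
    ring

end AddEdge

/-- Cutting off a triangle from a face, by an edge from the start of a dart `d₀` to the end of the next
dart along the face, preserves planarity. -/
lemma exists_ear {M : RotationSystem} (hM : M.Planar) (hloop : ∀ d, M.src d ≠ M.tgt d) {d₀ : M.Dart}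
    (huw : M.src d₀ ≠ M.tgt (M.face d₀)) :
    ∃ (A B : M.Dart ⊕ Bool) (hA : M.IsCorner (M.src d₀) false A)
      (hB : M.IsCorner (M.tgt (M.face d₀)) true B), (addEdge huw hA hB).Planar := by
  classical
  have hfn : ∀ d, M.face d ≠ d := fun d h => hloop d (by rw [← M.src_face, h])
  have hA : M.IsCorner (M.src d₀) false (Sum.inl (M.rot d₀)) := Or.inl ⟨_, rfl, M.src_rot _⟩
  have hB : M.IsCorner (M.tgt (M.face d₀)) true (Sum.inl (M.rev (M.face d₀))) :=
    Or.inl ⟨_, rfl, rfl⟩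
  refine ⟨_, _, hA, hB, planar_of_potential _ fun y g hy hg => ?_⟩
  have hypq : y (Sum.inr true) = -y (Sum.inr false) := hy (Sum.inr false)
  set d₁ := M.face d₀ with hd₁
  have hd₂ : M.face d₁ ≠ d₀ := fun h => huw (by rw [← M.src_face d₁, h])
  have hpre : M.rot d₀ = M.rev (M.rev (M.rot d₀)) := (M.rev_rev _).symm
  have f1 := addEdge_face_right huw hA hB (d := d₁) rfl
  have f2 := addEdge_face_left huw hA hB (d := M.rev (M.rot d₀)) (congrArg Sum.inl hpre)
  rw [M.face_rev_rot] at f2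
  have f3 : ∀ d, M.face d ≠ d₀ → d ≠ d₁ →
      (addEdge huw hA hB).face (Sum.inl d) = Sum.inl (M.face d) := by
    intro d h1 h2
    refine addEdge_face_inl huw hA hB ?_ ?_
    · rw [Ne, Sum.inl.injEq, ← M.rot_face]
      exact fun e => h1 (M.rot.injective e).symm
    · rw [Ne, Sum.inl.injEq]
      exact fun e => h2 (M.rev.injective e).symm
  have e1 := hg (Sum.inl d₁)
  have e2 := hg (Sum.inr false)
  have e3 := hg (Sum.inr true)
  have e4 := hg (Sum.inl d₀)
  rw [f1.1] at e1
  rw [f1.2] at e2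
  rw [f2.2] at e3
  rw [f3 d₀ (hfn _) (hfn _).symm, ← hd₁] at e4
  -- the old primitive along the face, taken along the new edge instead of `d₀` and `d₁`
  let g₀ : M.Dart → ℚ := fun d =>
    if d = d₀ then g (Sum.inr false) else
      if d = d₁ then g (Sum.inr false) + y (Sum.inl d₀) else g (Sum.inl d)
  have g1 : g₀ d₀ = g (Sum.inr false) := by simp [g₀]
  have g2 : g₀ d₁ = g (Sum.inr false) + y (Sum.inl d₀) := by simp [g₀, hd₁, hfn]
  have g3 : ∀ d, d ≠ d₀ → d ≠ d₁ → g₀ d = g (Sum.inl d) := fun d h h' => by simp [g₀, h, h']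
  obtain ⟨p, hp⟩ := hM.exists_vertex_potential (fun d => y (Sum.inl d)) g₀
    (fun d => hy (Sum.inl d)) (fun d => by
      by_cases h0 : d = d₀
      · rw [h0, ← hd₁, g1, g2]; ring
      · by_cases h1 : d = d₁
        · rw [h1, g2, g3 _ hd₂ (hfn _)]
          linarith
        · have e := hg (Sum.inl d)
          by_cases h2 : M.face d = d₀
          · have : d = M.rev (M.rot d₀) := by
              rw [← h2, M.rot_face, M.rev_rev]
            rw [h2, g1, g3 d h0 h1]
            rw [this, f2.1] at e
            rw [this, e]
          · rw [f3 d h2 h1] at e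
            rw [g3 d h0 h1, g3 _ h2 (fun h => h0 (M.face.injective h)), e])
  have hp01 : y (Sum.inr false) = p (M.tgt d₁) - p (M.src d₀) := by
    have h0 : y (Sum.inl d₀) = p (M.tgt d₀) - p (M.src d₀) := hp d₀
    have h1 : y (Sum.inl d₁) = p (M.tgt d₁) - p (M.src d₁) := hp d₁
    rw [hd₁, M.src_face, ← hd₁] at h1
    linarith
  refine ⟨p, ?_⟩
  rintro (d | (_ | _))
  · exact hp d
  · exact hp01
  · rw [hypq, hp01]
    change _ = p (M.src d₀) - p (M.tgt d₁)
    ring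

/-! ### Maximal planar graphs -/

lemma addEdge_isDrawingOf {M : RotationSystem} {V : Type*} {G : SimpleGraph V} (e : V ≃ M.Vert)
    (he : ∀ u v, (G.Adj u v → ∃! d, M.src d = e u ∧ M.tgt d = e v) ∧
      (M.Adjacent (e u) (e v) → G.Adj u v)) {u w : M.Vert} {A B : M.Dart ⊕ Bool} (huw : u ≠ w)
    (hA : M.IsCorner u false A) (hB : M.IsCorner w true B) (hn : ¬ M.Adjacent u w) :
    (addEdge huw hA hB).IsDrawingOf (G ⊔ SimpleGraph.edge (e.symm u) (e.symm w)) := by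
  have hn' : ¬ M.Adjacent w u := fun h => hn h.symm
  have hadj : ∀ x y, (G ⊔ SimpleGraph.edge (e.symm u) (e.symm w)).Adj x y ↔
      G.Adj x y ∨ (u = e x ∧ w = e y) ∨ (w = e x ∧ u = e y) := by
    intro x y
    rw [SimpleGraph.sup_adj, SimpleGraph.edge_adj]
    refine or_congr_right ?_
    constructor
    · rintro ⟨⟨rfl, rfl⟩ | ⟨rfl, rfl⟩, -⟩ <;> simp
    · rintro (⟨rfl, rfl⟩ | ⟨rfl, rfl⟩)
      · simpa using huw
      · simpa using huw.symm
  have hG : ∀ d x y, M.src d = e x → M.tgt d = e y → G.Adj x y := fun d x y h h' =>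
    (he x y).2 ⟨d, h, h'⟩
  refine ⟨e, fun x y => ⟨fun hxy => ?_, ?_⟩⟩
  · rcases (hadj x y).1 hxy with hG' | ⟨hx, hy⟩ | ⟨hx, hy⟩
    · obtain ⟨d, hd, huniq⟩ := (he x y).1 hG'
      have hMadj : M.Adjacent (e x) (e y) := ⟨d, hd⟩
      refine ⟨Sum.inl d, hd, ?_⟩
      rintro (d' | (_ | _)) h
      · exact congrArg Sum.inl (huniq d' h)
      · have h1 : u = e x := h.1
        have h2 : w = e y := h.2
        exact absurd (h1 ▸ h2 ▸ hMadj) hn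
      · have h1 : w = e x := h.1
        have h2 : u = e y := h.2
        exact absurd (h1 ▸ h2 ▸ hMadj) hn'
    · refine ⟨Sum.inr false, ⟨hx, hy⟩, ?_⟩
      rintro (d' | (_ | _)) h
      · exact absurd ⟨d', h.1.trans hx.symm, h.2.trans hy.symm⟩ hn
      · rfl
      · exact absurd (h.1.trans hx.symm).symm huw
    · refine ⟨Sum.inr true, ⟨hx, hy⟩, ?_⟩
      rintro (d' | (_ | _)) h
      · exact absurd ⟨d', h.1.trans hx.symm, h.2.trans hy.symm⟩ hn'
      · exact absurd (h.1.trans hx.symm) huw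
      · rfl
  · rintro ⟨d | (_ | _), h1, h2⟩
    · exact (hadj x y).2 (Or.inl (hG d x y h1 h2))
    · exact (hadj x y).2 (Or.inr (Or.inl ⟨h1, h2⟩))
    · exact (hadj x y).2 (Or.inr (Or.inr ⟨h1, h2⟩))

lemma not_planar_addEdge {M : RotationSystem} {V : Type*} {G : SimpleGraph V}
    (hG : IsMaximalPlanarGraph G) (hd : M.IsDrawingOf G)
    {u w : M.Vert} {A B : M.Dart ⊕ Bool} (huw : u ≠ w)
    (hA : M.IsCorner u false A) (hB : M.IsCorner w true B) (hn : ¬ M.Adjacent u w) :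
    ¬ (addEdge huw hA hB).Planar := by
  obtain ⟨e, he⟩ := hd
  intro hpl
  refine hG.2 _ (lt_of_le_of_ne le_sup_left fun heq => ?_)
    ⟨_, hpl, addEdge_isDrawingOf e he huw hA hB hn⟩
  have h1 : G.Adj (e.symm u) (e.symm w) := by
    rw [heq, SimpleGraph.sup_adj, SimpleGraph.edge_adj]
    exact Or.inr ⟨Or.inl ⟨rfl, rfl⟩, e.symm.injective.ne huw⟩
  obtain ⟨d, hd, -⟩ := (he _ _).1 h1
  exact hn ⟨d, by simpa using hd⟩

/-- Let the darts `d₀` and `face d₀` lead from `v₀` over `v₁` to `v₂`, with `v₀` and `v₂` distinct and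
adjacent. Then `v₁` is not adjacent to any further vertex of the face: the triangle `v₀ v₁ v₂` separates
this face from all other corners at `v₁`. The hypothesis `hf` says that `f` lies in the face of
`d₀`. -/
lemma Planar.not_adjacent_of_chord {M : RotationSystem} (hM : M.Planar)
    (hloop : ∀ d, M.src d ≠ M.tgt d) {d₀ f : M.Dart} (h02 : M.src d₀ ≠ M.tgt (M.face d₀))
    (hchord : M.Adjacent (M.src d₀) (M.tgt (M.face d₀)))
    (hf : ∀ φ : M.Dart → ℚ, (∀ d, φ (M.face d) = φ d) → φ f = φ d₀)
    (hf0 : M.src f ≠ M.src d₀) (hf1 : M.src f ≠ M.tgt d₀) (hf2 : M.src f ≠ M.tgt (M.face d₀)) :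
    ¬ M.Adjacent (M.tgt d₀) (M.src f) := by
  classical
  rintro ⟨x, hx, hxf⟩
  obtain ⟨e, he, he'⟩ := hchord.symm
  have hs1 : M.src (M.face d₀) = M.tgt d₀ := M.src_face d₀
  have h01 := hloop d₀
  have h12 := hloop (M.face d₀)
  rw [hs1] at h12
  obtain ⟨φ, hφ, hjump⟩ := hM.jordan [d₀, M.face d₀, e] (by
    simp only [List.map_cons, List.map_nil, he, he', hs1]
    exact (List.perm_append_singleton _ [_, _]).symm)
  obtain ⟨hother, hconst⟩ := jump_eq_of_notMem hφ hjump
  have hmem : ∀ y, y ∈ [d₀, M.face d₀, e] → (M.src y = M.src d₀ ∧ M.tgt y = M.tgt d₀) ∨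
      y = M.face d₀ ∨ (M.src y = M.tgt (M.face d₀) ∧ M.tgt y = M.src d₀) := by
    intro y hy
    simp only [List.mem_cons, List.not_mem_nil, or_false] at hy
    rcases hy with rfl | rfl | rfl
    · exact Or.inl ⟨rfl, rfl⟩
    · exact Or.inr (Or.inl rfl)
    · exact Or.inr (Or.inr ⟨he, he'⟩)
  -- a dart at the middle vertex other than those of the face corner does not belong to the triangle
  have hnm : ∀ y, M.src y = M.tgt d₀ → y ≠ M.face d₀ → y ∉ [d₀, M.face d₀, e] := by
    intro y hy hne hy'
    rcases hmem y hy' with h | h | h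
    · exact h01 (h.1.symm.trans hy)
    · exact hne h
    · exact h12 (hy.symm.trans h.1)
  have hnm' : ∀ y, M.src y = M.tgt d₀ → y ≠ M.rev d₀ → M.rev y ∉ [d₀, M.face d₀, e] := by
    intro y hy hne hy'
    simp only [List.mem_cons, List.not_mem_nil, or_false] at hy'
    rcases hy' with h | h | h
    · exact hne (M.rev_inj h)
    · exact h12 (by rw [← h, M.tgt_rev, hy])
    · exact h01 (by rw [← he', ← h, M.tgt_rev, hy])
  have j0 : φ d₀ - φ (M.rev d₀) = 1 := by
    have a1 : M.face d₀ ≠ d₀ := fun h => h01 (by rw [← hs1, h])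
    have a2 : e ≠ d₀ := fun h => h02 (by rw [← he, h])
    have a3 : M.rev d₀ ∉ [d₀, M.face d₀, e] := by
      refine hnm _ rfl fun h => h02 ?_
      rw [← h, M.tgt_rev]
    rw [hjump, List.count_eq_zero_of_not_mem a3]
    simp [a1, a2]
  have j1 : φ (M.face d₀) - φ (M.rev (M.face d₀)) = 1 := by
    have a1 : d₀ ≠ M.face d₀ := fun h => h01 (by rw [← hs1, ← h])
    have a2 : e ≠ M.face d₀ := fun h => h12 (by rw [← hs1, ← he, h])
    have a3 : M.rev (M.face d₀) ∉ [d₀, M.face d₀, e] := by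
      refine hnm' _ hs1 fun h => h02 ?_
      rw [h, M.tgt_rev]
    rw [hjump, List.count_eq_zero_of_not_mem a3]
    simp [a1, a2]
  have hrev01 : M.rev d₀ ≠ M.face d₀ := fun h => h02 (by rw [← h, M.tgt_rev])
  -- all corners at the middle vertex but that of the face itself lie across the triangle
  have hside : ∀ y, M.src y = M.tgt d₀ → y ≠ M.face d₀ → φ y = φ d₀ - 1 := by
    let g : M.Dart → ℚ := fun d => if d = M.face d₀ then φ d₀ - 1 else φ d
    have hg1 : g (M.face d₀) = φ d₀ - 1 := if_pos rfl
    have hg2 : ∀ d, d ≠ M.face d₀ → g d = φ d := fun d h => if_neg h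
    have hg : ∀ d, M.src d = M.tgt d₀ → g (M.rot d) = g d := by
      intro d hd
      have hback : φ (M.rev (M.rot d)) = φ d := by rw [← hφ (M.rev _), M.face_rev_rot]
      by_cases h1 : d = M.face d₀
      · rw [h1, M.rot_face, hg1, hg2 _ hrev01]
        linarith
      · rw [hg2 d h1]
        by_cases h2 : M.rot d = M.face d₀
        · rw [h2] at hback
          rw [h2, hg1, ← hback, ← hφ d₀]
          linarith
        · rw [hg2 _ h2, ← hback, hother]
          · exact hnm _ (by rw [M.src_rot, hd]) h2
          · refine hnm' _ (by rw [M.src_rot, hd]) fun h => h1 ?_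
            rw [← M.rot_face] at h
            exact M.rot.injective h
    intro y hy hne
    rw [← hg2 y hne, M.eq_of_src_eq hg hy hs1, hg1]
  have hx1 : x ≠ M.face d₀ := fun h => hf2 (by rw [← hxf, h])
  have hx2 : φ (M.rev x) = φ x := by
    refine hother x (hnm x hx hx1) (hnm' x hx fun h => hf0 ?_)
    rw [← hxf, h, M.tgt_rev]
  have hx3 : φ (M.rev x) = φ f := by
    refine hconst (M.src f) (fun y hy => ?_) _ _ hxf rfl
    rcases hmem y hy with h | rfl | h
    · rw [h.1, h.2]; exact ⟨hf0.symm, hf1.symm⟩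
    · rw [hs1]; exact ⟨hf1.symm, hf2.symm⟩
    · rw [h.1, h.2]; exact ⟨hf2.symm, hf0.symm⟩
  have := hside x hx hx1
  rw [← hx2, hx3, hf φ hφ] at this
  linarith

/-- A plane drawing of a maximal planar graph is connected, since components can be joined. Any two
vertices at distance two along a face are adjacent or equal, since otherwise an ear could be cut off;
equality is excluded as well, as it gives a leaf and thus another ear. A face with more than three edges
would then contradict `Planar.not_adjacent_of_chord`. -/
theorem isTriangulation_of_isMaximalPlanarGraph {V : Type*} {G : SimpleGraph V}
    (h3 : 3 ≤ Nat.card V) (hG : IsMaximalPlanarGraph G) {M : RotationSystem} (hM : M.Planar)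
    (hd : M.IsDrawingOf G) : M.IsTriangulation := by
  have hnp := @not_planar_addEdge M V G hG hd
  obtain ⟨e, he⟩ := hd
  have hcard : 3 ≤ Nat.card M.Vert := by rwa [← Nat.card_congr e]
  have hadj : ∀ d, G.Adj (e.symm (M.src d)) (e.symm (M.tgt d)) := fun d =>
    (he _ _).2 ⟨d, by simp⟩
  have hloop : ∀ d, M.src d ≠ M.tgt d := fun d h => (hadj d).ne (congrArg e.symm h)
  have hsimple : ∀ d d', M.src d = M.src d' → M.tgt d = M.tgt d' → d = d' := fun d d' h h' =>
    ((he _ _).1 (hadj d)).unique (by simp) (by simp [h, h'])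
  have hconn : ∀ u v, ReflTransGen M.Adjacent u v := by
    intro u w
    by_contra h
    have huw : u ≠ w := by rintro rfl; exact h ReflTransGen.refl
    obtain ⟨A, hA⟩ := M.exists_isCorner u false
    obtain ⟨B, hB⟩ := M.exists_isCorner w true
    exact hnp huw hA hB (fun h' => h (ReflTransGen.single h'))
      (addEdge_planar_of_not_reachable huw hA hB hM h)
  have hear : ∀ d, M.src d ≠ M.tgt (M.face d) → M.Adjacent (M.src d) (M.tgt (M.face d)) := by
    intro d hne
    by_contra h
    obtain ⟨A, B, hA, hB, hp⟩ := exists_ear hM hloop hne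
    exact hnp hne hA hB h hp
  have honly : ∀ x, M.rot x = x → ∀ y, M.src y = M.src x → y = x := by
    intro x hx y hy
    have : (y = x) = (x = x) := M.eq_of_src_eq (g := fun d => d = x) (fun d _ => propext
      ⟨fun h => M.rot.injective (h.trans hx.symm), fun h => by rw [h, hx]⟩) hy rfl
    exact this.mpr rfl
  have hdist : ∀ d, M.src d ≠ M.tgt (M.face d) := by
    intro d h
    -- otherwise the end of `d` is a leaf
    have h1 : M.face d = M.rev d := hsimple _ _ (M.src_face d) (by rw [M.tgt_rev, h])
    have hleaf : M.rot (M.rev d) = M.rev d := by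
      have h2 := M.rot_face d
      rwa [h1] at h2
    have h2 : M.src (M.face (M.rev d)) = M.src d := by rw [M.src_face, M.tgt_rev]
    by_cases h4 : M.tgt (M.face (M.rev d)) = M.tgt d
    · have h5 : M.rot d = d := by
        have h6 := hsimple _ _ h2 h4
        have h7 := M.rot_face (M.rev d)
        rw [h6, M.rev_rev] at h7
        exact h7
      have hall : ∀ v, v = M.src d ∨ v = M.tgt d := by
        intro v
        induction hconn (M.src d) v with
        | refl => exact Or.inl rfl
        | tail _ hstep ih =>
          obtain ⟨x, hx, rfl⟩ := hstep
          rcases ih with rfl | rfl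
          · rw [honly d h5 x hx]; exact Or.inr rfl
          · rw [honly _ hleaf x hx, M.tgt_rev]; exact Or.inl rfl
      have h8 : (Set.univ : Set M.Vert).ncard ≤ 2 :=
        (Set.ncard_le_ncard (t := {M.src d, M.tgt d}) fun v _ => hall v).trans 
          ((Set.ncard_insert_le _ _).trans (by simp))
      rw [Set.ncard_univ] at h8
      omega
    · have h5 := hear (M.rev d) (by rw [M.src_rev]; exact fun h => h4 h.symm)
      obtain ⟨x, hx, hx'⟩ := h5
      rw [honly _ hleaf x hx, M.tgt_rev, ← h2] at hx'
      exact hloop _ hx'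
  refine ⟨hM, hcard, hconn, hloop, fun d₀ => ?_⟩
  have hX : ∀ d f, (∀ φ : M.Dart → ℚ, (∀ d, φ (M.face d) = φ d) → φ f = φ d) →
      M.src f ≠ M.src d → M.src f ≠ M.tgt d → M.src f ≠ M.tgt (M.face d) →
      ¬ M.Adjacent (M.tgt d) (M.src f) := fun d f =>
    hM.not_adjacent_of_chord hloop (hdist d) (hear d (hdist d))
  by_contra hne
  -- the walk `v₀ v₁ v₂ v₃` along the face either returns to `v₀` (and goes on) or gives four vertices
  by_cases h30 : M.tgt (M.face (M.face d₀)) = M.src d₀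
  · have s3 : M.src (M.face (M.face (M.face d₀))) = M.src d₀ := by rw [M.src_face, h30]
    refine hX (M.face (M.face d₀)) (M.face d₀) (fun φ hφ => (hφ _).symm) ?_ ?_ ?_ ?_
    · rw [M.src_face (M.face d₀)]; exact hloop _
    · rw [h30, M.src_face]; exact (hloop _).symm
    · rw [M.src_face]
      exact fun h => hne (hsimple _ _ s3 h.symm)
    · rw [h30, M.src_face]
      exact ⟨d₀, rfl, rfl⟩
  · refine hX d₀ (M.face (M.face (M.face d₀))) (fun φ hφ => by rw [hφ, hφ, hφ]) ?_ ?_ ?_ ?_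
    · rwa [M.src_face]
    · rw [M.src_face, ← M.src_face d₀]
      exact (hdist (M.face d₀)).symm
    · rw [M.src_face, ← M.src_face (M.face d₀)]
      exact (hloop _).symm
    · rw [M.src_face, ← M.src_face d₀]
      exact hear _ (hdist _)

end RotationSystem

theorem theorem3p4 :
    -- maximal planar graphs in the wide sense: triangulations, parallel edges allowed
    (∀ M : RotationSystem, M.IsTriangulation → M.ReducesToK3) ∧
    (∀ M N : RotationSystem, M.IsTriangulation → N.IsTriangulation → M.TransformsInto N) ∧
    -- maximal planar simple graphs, in every plane drawing
    (∀ (V : Type*) [Finite V] (G : SimpleGraph V), 3 ≤ Nat.card V → IsMaximalPlanarGraph G →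
      ∀ M : RotationSystem, M.Planar → M.IsDrawingOf G → M.IsTriangulation ∧ M.ReducesToK3) ∧
    (∀ (V W : Type*) [Finite V] [Finite W] (G : SimpleGraph V) (H : SimpleGraph W),
      3 ≤ Nat.card V → 3 ≤ Nat.card W → IsMaximalPlanarGraph G → IsMaximalPlanarGraph H →
      ∀ M N : RotationSystem, M.Planar → M.IsDrawingOf G → N.Planar → N.IsDrawingOf H →
        M.TransformsInto N) := by
  refine ⟨fun M hM => hM.reducesToK3, fun M N hM hN => hM.transformsInto hN, ?_, ?_⟩
  · intro V _ G h3 hG M hM hd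
    have h := RotationSystem.isTriangulation_of_isMaximalPlanarGraph h3 hG hM hd
    exact ⟨h, h.reducesToK3⟩
  · intro V W _ _ G H hV hW hG hH M N hM hMG hN hNH
    exact (RotationSystem.isTriangulation_of_isMaximalPlanarGraph hV hG hM hMG).transformsInto
      (RotationSystem.isTriangulation_of_isMaximalPlanarGraph hW hH hN hNH)
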